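/- **Setting.** Let $\mathcal S$ be a convenient category of topological spaces: a full subcategory of the category of topological spaces which contains all convex subsets of finite-dimensional real vector spaces and has finite products (for example compactly generated weak Hausdorff spaces), regarded as a cartesian monoidal category. Let $(\mathcal M,\square,\mathbf 1)$ be a closed symmetric monoidal category with countable colimits, and let $L\colon\mathcal S\to\mathcal M$ be a strong symmetric monoidal functor that is a left adjoint. A homotopy between maps $f,g\colon X\to Y$ in $\mathcal M$ is a map $X\,\square\,L[0,1]\to Y$ that restricts to $f$ and $g$ along the maps $X\cong X\,\square\,L(*)\to X\,\square\,L[0,1]$ given by the endpoints $0$ and $1$; a map $f\colon X\to Y$ is a homotopy equivalence in $\mathcal M$ if there is $g\colon Y\to X$ such that $g\circ f$ and $f\circ g$ are homotopic to the identities. Let $\overline{\mathcal C}_1$ be the non-symmetric operad of little $1$-cubes: $\overline{\mathcal C}_1(m)$ is the space of lists $[x_1,y_1],\dots,[x_m,y_m]$ of subintervals of $[0,1]$ with $x_i<y_i$ and $y_i\le x_{i+1}$, the unit is $[0,1]$, and the composition $\Gamma$ is composition of the corresponding affine embeddings $[0,1]\to[0,1]$. Let $\overline{\mathcal O}=L\overline{\mathcal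 C}_1$ be the resulting non-symmetric operad in $\mathcal M$, and let $A$ be an $\overline{\mathcal O}$-algebra with action maps $\xi_m\colon \overline{\mathcal O}(m)\,\square\,A^{(m)}\to A$. The (left module) enveloping algebra $\overline UA$ is the coequalizer $$\coprod_{m\ge 0}\overline{\mathcal O}(m+1)\,\square\,\Bigl(\coprod_{j\ge0}\overline{\mathcal O}(j)\,\square\,A^{(j)}\Bigr)^{(m)}\rightrightarrows\coprod_{m\ge 0}\overline{\mathcal O}(m+1)\,\square\,A^{(m)}\to\overline UA$$ of the map induced by the action maps $\xi_j$ and the map induced by the operadic compositions $\Gamma^{m+1}_{j_1,\dots,j_m,1}(-;-,\dots,-,1)$, where the unit of the operad is inserted in the last input. **Proposition.** 1. $\overline UA$ has a $\square$-monoid structure whose unit is induced by $\mathbf 1\to\overline{\mathcal O}(1)$ and whose multiplication is induced by the maps $$(\overline{\mathcal O}(m+1)\,\square\,A^{(m)})\,\square\,(\overline{\mathcal O}(n+1)\,\square\,A^{(n)})\to\overline{\mathcal O}(m+n+1)\,\square\,A^{(m+n)}$$ given by $\circ_{m+1}=\Gamma^{m+1}_{1,\dots,1,n+1}(-;1,\dots,1,-)$,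 and $A$ has a left $\overline UA$-module structure induced by the maps $\xi_{m+1}\colon(\overline{\mathcal O}(m+1)\,\square\,A^{(m)})\,\square\,A\to A$. 2. With these structures, the composite $$\overline UA\cong\overline UA\,\square\,\mathbf 1\to\overline UA\,\square\,A\to A$$ of the map induced by $\mathbf 1\cong L\overline{\mathcal C}_1(0)\xrightarrow{\xi_0}A$ and the module action is a map of left $\overline UA$-modules and is a homotopy equivalence in $\mathcal M$. -/

import Mathlib

open CategoryTheory MonoidalCategory CartesianMonoidalCategory Limits

universe w v u

noncomputable section

namespace LittleIntervals

/-! ## Tuples of natural numbers and iterated products -/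

/-- An `m`-tuple `(j₁, …, j_m)` of natural numbers, built up from left to right. -/
inductive Arities : ℕ → Type
  | nil : Arities 0
  | snoc {m : ℕ} (j : Arities m) (a : ℕ) : Arities (m + 1)

namespace Arities

/-- The sum `j₁ + ⋯ + j_m`. -/
def sum : {m : ℕ} → Arities m → ℕ
  | _, nil => 0
  | _, snoc j a => j.sum + a

/-- The constant tuple `(1, …, 1)`. -/
def ones : (m : ℕ) → Arities m
  | 0 => nil
  | m + 1 => snoc (ones m) 1

theorem sum_ones : (m : ℕ) → (ones m).sum = m
  | 0 => rfl
  | m + 1 => congrArg (· + 1) (sum_ones m)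

/-- The list of entries, in reverse order. -/
def toList : {m : ℕ} → Arities m → List ℕ
  | _, nil => []
  | _, snoc j a => a :: j.toList

theorem toList_injective : {m : ℕ} → Function.Injective (toList : Arities m → List ℕ)
  | _, nil, nil, _ => rfl
  | _, snoc j a, snoc k b, h => by
    simp only [toList, List.cons.injEq] at h
    rw [h.1, toList_injective h.2]

instance (m : ℕ) : Countable (Arities m) := toList_injective.countable

end Arities

section Powers

variable {C : Type u} [Category.{v} C] [MonoidalCategory C]

/-- The product `X j₁ ⊗ ⋯ ⊗ X j_m`, bracketed from the left; the empty product is the unit. -/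
def tensorFam (X : ℕ → C) : {m : ℕ} → Arities m → C
  | _, .nil => 𝟙_ C
  | _, .snoc j a => tensorFam X j ⊗ X a

/-- The power `X^(m) = X ⊗ ⋯ ⊗ X`, bracketed from the left. -/
def tensorPow (X : C) : ℕ → C
  | 0 => 𝟙_ C
  | m + 1 => tensorPow X m ⊗ X

/-- The map `f j₁ ⊗ ⋯ ⊗ f j_m : X j₁ ⊗ ⋯ ⊗ X j_m ⟶ Y^(m)`. -/
def tensorFamToPow {X : ℕ → C} {Y : C} (f : ∀ n, X n ⟶ Y) :
    {m : ℕ} → (j : Arities m) → (tensorFam X j ⟶ tensorPow Y m)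
  | _, .nil => 𝟙 (𝟙_ C)
  | _, .snoc j a => tensorFamToPow f j ⊗ₘ f a

/-- The canonical isomorphism `X^(a) ⊗ X^(b) ⟶ X^(a + b)`. -/
def tensorPowAdd (X : C) (a : ℕ) : (b : ℕ) → (tensorPow X a ⊗ tensorPow X b ⟶ tensorPow X (a + b))
  | 0 => (ρ_ (tensorPow X a)).hom
  | b + 1 => (α_ (tensorPow X a) (tensorPow X b) X).inv ≫ tensorPowAdd X a b ▷ X

/-- The canonical isomorphism `X^(j₁) ⊗ ⋯ ⊗ X^(j_m) ⟶ X^(j₁ + ⋯ + j_m)`. -/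
def tensorPowFlatten (X : C) :
    {m : ℕ} → (j : Arities m) → (tensorFam (tensorPow X) j ⟶ tensorPow X j.sum)
  | _, .nil => 𝟙 (𝟙_ C)
  | _, .snoc j a =>
      tensorPowFlatten X j ▷ tensorPow X a ≫ tensorPowAdd X j.sum a

/-- The symmetry isomorphism
`(X j₁ ⊗ Y j₁) ⊗ ⋯ ⊗ (X j_m ⊗ Y j_m) ⟶ (X j₁ ⊗ ⋯ ⊗ X j_m) ⊗ (Y j₁ ⊗ ⋯ ⊗ Y j_m)`
which keeps the order of the `X`'s and of the `Y`'s. -/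
def unshuffle [BraidedCategory C] (X Y : ℕ → C) :
    {m : ℕ} → (j : Arities m) →
      (tensorFam (fun n => X n ⊗ Y n) j ⟶ tensorFam X j ⊗ tensorFam Y j)
  | _, .nil => (λ_ (𝟙_ C)).inv
  | _, .snoc j a =>
      unshuffle X Y j ▷ (X a ⊗ Y a) ≫ tensorμ (tensorFam X j) (tensorFam Y j) (X a) (Y a)

/-- The comparison map `F (X j₁) ⊗ ⋯ ⊗ F (X j_m) ⟶ F (X j₁ ⊗ ⋯ ⊗ X j_m)` of a monoidal functor. -/
def tensorFamComparison {D : Type*} [Category* D] [MonoidalCategory D] (F : C ⥤ D) [F.Monoidal]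
    (X : ℕ → C) : {m : ℕ} → (j : Arities m) →
      (tensorFam (fun n => F.obj (X n)) j ⟶ F.obj (tensorFam X j))
  | _, .nil => Functor.LaxMonoidal.ε F
  | _, .snoc j a => tensorFamComparison F X j ▷ F.obj (X a) ≫ Functor.LaxMonoidal.μ F _ _

end Powers

/-! ## Non-symmetric operads, algebras, enveloping algebras -/

/-- The data of a non-symmetric operad `O` in a monoidal category: its objects `O(m)`, its unit map
`1 ⟶ O(1)` and its composition maps `Γ`.  This is all that the definitions of algebras and of
enveloping algebras refer to; the associativity and unit laws hold for the operad of little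
intervals constructed below. -/
structure OperadData (C : Type u) [Category.{v} C] [MonoidalCategory C] where
  /-- The object `O(m)` of `m`-ary operations. -/
  obj : ℕ → C
  /-- The unit map. -/
  one : 𝟙_ C ⟶ obj 1
  /-- The composition `O(m) ⊗ (O(j₁) ⊗ ⋯ ⊗ O(j_m)) ⟶ O(j₁ + ⋯ + j_m)`. -/
  comp : ∀ {m : ℕ} (j : Arities m), obj m ⊗ tensorFam obj j ⟶ obj j.sum

namespace OperadData

variable {C : Type u} [Category.{v} C] [MonoidalCategory C]

/-- The image `F O` of an operad under a strong monoidal functor `F`. -/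
def map {D : Type*} [Category* D] [MonoidalCategory D] (O : OperadData C) (F : C ⥤ D)
    [F.Monoidal] : OperadData D where
  obj m := F.obj (O.obj m)
  one := Functor.LaxMonoidal.ε F ≫ F.map O.one
  comp {m} j :=
    F.obj (O.obj m) ◁ tensorFamComparison F O.obj j ≫ Functor.LaxMonoidal.μ F _ _ ≫
      F.map (O.comp j)

variable (O : OperadData C)

/-- The map `1 ⟶ O(1) ⊗ ⋯ ⊗ O(1)` given by the unit of the operad in every factor. -/
def oneFam : (m : ℕ) → (𝟙_ C ⟶ tensorFam O.obj (Arities.ones m))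
  | 0 => 𝟙 (𝟙_ C)
  | m + 1 => (λ_ (𝟙_ C)).inv ≫ (oneFam m ⊗ₘ O.one)

/-- The map `Γ(-; -, …, -, 1) : O(m+1) ⊗ (O(j₁) ⊗ ⋯ ⊗ O(j_m)) ⟶ O(j₁ + ⋯ + j_m + 1)`
which plugs the operad unit into the last input. -/
def compOne {m : ℕ} (j : Arities m) : O.obj (m + 1) ⊗ tensorFam O.obj j ⟶ O.obj (j.sum + 1) :=
  O.obj (m + 1) ◁ ((ρ_ (tensorFam O.obj j)).inv ≫ tensorFam O.obj j ◁ O.one) ≫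
    O.comp (Arities.snoc j 1)

/-- The partial composition `∘_{m+1} = Γ(-; 1, …, 1, -) : O(m+1) ⊗ O(n+1) ⟶ O(m+n+1)`
in the last input. -/
def compLast (m n : ℕ) : O.obj (m + 1) ⊗ O.obj (n + 1) ⟶ O.obj (m + n + 1) :=
  O.obj (m + 1) ◁ ((λ_ (O.obj (n + 1))).inv ≫ O.oneFam m ▷ O.obj (n + 1)) ≫
    O.comp (Arities.snoc (Arities.ones m) (n + 1)) ≫
      eqToHom (congrArg (fun k => O.obj (k + (n + 1))) (Arities.sum_ones m))

end OperadData

section Algebras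

variable {M : Type u} [Category.{v} M] [MonoidalCategory M] [SymmetricCategory M]

/-- An algebra over a non-symmetric operad.  In the associativity law both sides are precomposed
with the symmetry isomorphism that brings each `A^(j_i)` next to `O(j_i)`. -/
structure OperadAlgebra (O : OperadData M) where
  /-- The underlying object `A`. -/
  X : M
  /-- The action maps `ξ_m : O(m) ⊗ A^(m) ⟶ A`. -/
  act : ∀ m : ℕ, O.obj m ⊗ tensorPow X m ⟶ X
  act_comp : ∀ {m : ℕ} (j : Arities m),
    O.obj m ◁ tensorFamToPow act j ≫ act m =
      O.obj m ◁ (unshuffle O.obj (tensorPow X) j ≫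
          tensorFam O.obj j ◁ tensorPowFlatten X j) ≫
        (α_ (O.obj m) (tensorFam O.obj j) (tensorPow X j.sum)).inv ≫
          O.comp j ▷ tensorPow X j.sum ≫ act j.sum
  act_one : O.one ▷ X ≫ O.obj 1 ◁ (λ_ X).inv ≫ act 1 = (λ_ X).hom

namespace OperadAlgebra

variable {O : OperadData M} (A : OperadAlgebra O)

/-- The object `O(m+1) ⊗ A^(m)`. -/
def envSummand (m : ℕ) : M := O.obj (m + 1) ⊗ tensorPow A.X m

/-- The object `O(m+1) ⊗ ((O(j₁) ⊗ A^(j₁)) ⊗ ⋯ ⊗ (O(j_m) ⊗ A^(j_m)))`. The coproduct of these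
objects over all `m` and all `(j₁, …, j_m)` is `∐ₘ O(m+1) ⊗ (∐ⱼ O(j) ⊗ A^(j))^(m)`. -/
def envRelation (s : Σ m : ℕ, Arities m) : M :=
  O.obj (s.1 + 1) ⊗ tensorFam (fun n => O.obj n ⊗ tensorPow A.X n) s.2

/-- The map given by the action maps `O(j_i) ⊗ A^(j_i) ⟶ A`. -/
def envAct (s : Σ m : ℕ, Arities m) : A.envRelation s ⟶ A.envSummand s.1 :=
  O.obj (s.1 + 1) ◁ tensorFamToPow A.act s.2

/-- The map given by the operadic multiplication `Γ(-; -, …, -, 1)`. -/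
def envComp (s : Σ m : ℕ, Arities m) : A.envRelation s ⟶ A.envSummand s.2.sum :=
  O.obj (s.1 + 1) ◁ (unshuffle O.obj (tensorPow A.X) s.2 ≫
      tensorFam O.obj s.2 ◁ tensorPowFlatten A.X s.2) ≫
    (α_ (O.obj (s.1 + 1)) (tensorFam O.obj s.2) (tensorPow A.X s.2.sum)).inv ≫
      O.compOne s.2 ▷ tensorPow A.X s.2.sum

variable [HasCountableColimits M]

/-- The underlying object of the (left module) enveloping algebra of `A`, a coequalizer of
two maps `∐ₘ O(m+1) ⊗ (∐ⱼ O(j) ⊗ A^(j))^(m) ⇉ ∐ₘ O(m+1) ⊗ A^(m)`. -/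
def env : M :=
  coequalizer
    (Sigma.desc fun s => A.envAct s ≫ Sigma.ι A.envSummand s.1)
    (Sigma.desc fun s => A.envComp s ≫ Sigma.ι A.envSummand s.2.sum)

/-- The canonical map `O(m+1) ⊗ A^(m) ⟶ env A`. -/
def envι (m : ℕ) : O.obj (m + 1) ⊗ tensorPow A.X m ⟶ A.env :=
  Sigma.ι A.envSummand m ≫ coequalizer.π _ _

/-- The multiplication
`(O(m+1) ⊗ A^(m)) ⊗ (O(n+1) ⊗ A^(n)) ⟶ O(m+n+1) ⊗ A^(m+n)` given by `∘_{m+1}`. -/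
def envMulSummand (m n : ℕ) :
    (O.obj (m + 1) ⊗ tensorPow A.X m) ⊗ (O.obj (n + 1) ⊗ tensorPow A.X n) ⟶
      O.obj (m + n + 1) ⊗ tensorPow A.X (m + n) :=
  tensorμ (O.obj (m + 1)) (tensorPow A.X m) (O.obj (n + 1)) (tensorPow A.X n) ≫
    (O.compLast m n ⊗ₘ tensorPowAdd A.X m n)

/-- The enveloping algebra structure: the monoid structure on `env A` induced by the operad unit
and by `∘_{m+1}`, and the left `env A`-module structure on `A` induced by the action maps
`O(m+1) ⊗ A^(m) ⊗ A ⟶ A`.  Both are determined by the equations below. -/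
structure EnvStructure where
  mon : MonObj A.env
  one_eq : mon.one = O.one ≫ (ρ_ (O.obj 1)).inv ≫ A.envι 0
  ι_mul : ∀ m n : ℕ,
    (A.envι m ⊗ₘ A.envι n) ≫ mon.mul = A.envMulSummand m n ≫ A.envι (m + n)
  mod : ModObj A.env A.X
  ι_smul : ∀ m : ℕ, A.envι m ▷ A.X ≫ mod.smul =
    (α_ (O.obj (m + 1)) (tensorPow A.X m) A.X).hom ≫ A.act (m + 1)

/-- The map `env A ≅ env A ⊗ 1 ⟶ env A ⊗ A ⟶ A` induced by a map `e : 1 ⟶ A` and the action. -/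
def EnvStructure.orbitMap {A : OperadAlgebra O} (E : A.EnvStructure) (e : 𝟙_ M ⟶ A.X) :
    A.env ⟶ A.X :=
  (ρ_ A.env).inv ≫ A.env ◁ e ≫ E.mod.smul

/-- `f : env A ⟶ A` is a map of left `env A`-modules, where `env A` acts on itself by left
multiplication. -/
def EnvStructure.IsModuleMap {A : OperadAlgebra O} (E : A.EnvStructure) (f : A.env ⟶ A.X) : Prop :=
  @IsModHom M _ _ M _ _ A.env E.mon A.env A.X (@ModObj.regular M _ _ A.env E.mon) E.mod f

end OperadAlgebra

end Algebras

/-! ## Spaces and the operad of little intervals -/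

/-- The class of spaces `P` contains the convex subsets of finite-dimensional real vector spaces.
This holds for the usual convenient categories of spaces, such as compactly generated spaces,
compactly generated weak Hausdorff spaces, or delta-generated spaces. -/
class ContainsConvexSets (P : ObjectProperty TopCat.{w}) : Prop where
  prop_of_convex : ∀ (E : Type) [NormedAddCommGroup E] [NormedSpace ℝ E] [FiniteDimensional ℝ E]
    (K : Set E), Convex ℝ K → P (TopCat.of (ULift.{w} K))

section Spaces

variable (P : ObjectProperty TopCat.{w})

variable {P} in
/-- A constant map. -/
def constMap {X Y : P.FullSubcategory} (y : Y.obj) : X ⟶ Y :=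
  ObjectProperty.homMk (TopCat.ofHom (ContinuousMap.const _ y))

variable [ContainsConvexSets P]

/-- The unit interval `[0, 1]` as a space. -/
def unitInterval : P.FullSubcategory where
  obj := TopCat.of (ULift.{w} (Set.Icc (0 : ℝ) 1))
  property := ContainsConvexSets.prop_of_convex ℝ _ (convex_Icc 0 1)

/-- Lists `[x₁, y₁], …, [x_m, y_m]` of subintervals of `[0, 1]` of positive length, which do not
overlap except at their endpoints and are listed in their natural order. A subinterval `[x, y]`
stands for the affine embedding `t ↦ x + (y - x) t` and is recorded as the pair `(x, y)`. -/
def intervalSet (m : ℕ) : Set (Fin m → ℝ × ℝ) :=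
  {c | (∀ i, 0 ≤ (c i).1 ∧ (c i).1 < (c i).2 ∧ (c i).2 ≤ 1) ∧
    ∀ i k, i < k → (c i).2 ≤ (c k).1}

theorem convex_intervalSet (m : ℕ) : Convex ℝ (intervalSet m) := by
  intro c hc d hd a b ha hb hab
  have key : ∀ x y x' y' : ℝ, x ≤ y → x' ≤ y' → a * x + b * x' ≤ a * y + b * y' :=
    fun x y x' y' h h' =>
      add_le_add (mul_le_mul_of_nonneg_left h ha) (mul_le_mul_of_nonneg_left h' hb)
  refine ⟨fun i => ?_, fun i k hik => ?_⟩
  · simp only [Pi.add_apply, Pi.smul_apply, Prod.fst_add, Prod.snd_add, Prod.smul_fst,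
      Prod.smul_snd, smul_eq_mul]
    obtain ⟨h1, h2, h3⟩ := hc.1 i
    obtain ⟨h1', h2', h3'⟩ := hd.1 i
    refine ⟨?_, ?_, ?_⟩
    · have := key _ _ _ _ h1 h1'
      linarith
    · rcases ha.eq_or_lt with h0 | h0
      · have hb1 : b = 1 := by linarith
        subst hb1
        rw [← h0]
        linarith
      · have := mul_lt_mul_of_pos_left h2 h0
        have := mul_le_mul_of_nonneg_left h2'.le hb
        linarith
    · have := key _ _ _ _ h3 h3'
      linarith
  · simp only [Pi.add_apply, Pi.smul_apply, Prod.fst_add, Prod.snd_add, Prod.smul_fst,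
      Prod.smul_snd, smul_eq_mul]
    exact key _ _ _ _ (hc.2 i k hik) (hd.2 i k hik)

/-- The space of `m` little intervals in their natural order. -/
def intervals (m : ℕ) : P.FullSubcategory where
  obj := TopCat.of (ULift.{w} (intervalSet m))
  property := ContainsConvexSets.prop_of_convex _ _ (convex_intervalSet m)

variable {P} in
/-- The list of pairs of endpoints of a point of the space of little intervals. -/
def endpoints {m : ℕ} (c : (intervals P m).obj) : Fin m → ℝ × ℝ :=
  (ULift.down (α := intervalSet m) c).1

variable {P} in
theorem endpoints_mem {m : ℕ} (c : (intervals P m).obj) : endpoints c ∈ intervalSet m :=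
  (ULift.down (α := intervalSet m) c).2

variable {P} in
theorem continuous_endpoints {m : ℕ} : Continuous (endpoints (P := P) (m := m)) :=
  continuous_subtype_val.comp continuous_uliftDown

/-- The composite of the affine embeddings corresponding to two intervals. -/
def rescale (p q : ℝ × ℝ) : ℝ × ℝ := (p.1 + (p.2 - p.1) * q.1, p.1 + (p.2 - p.1) * q.2)

theorem rescale_mem {p q : ℝ × ℝ} (hp : 0 ≤ p.1 ∧ p.1 < p.2 ∧ p.2 ≤ 1)
    (hq : 0 ≤ q.1 ∧ q.1 < q.2 ∧ q.2 ≤ 1) :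
    p.1 ≤ (rescale p q).1 ∧ (rescale p q).1 < (rescale p q).2 ∧ (rescale p q).2 ≤ p.2 := by
  have hpos := sub_pos.2 hp.2.1
  refine ⟨?_, ?_, ?_⟩ <;> simp only [rescale]
  · have := mul_nonneg hpos.le hq.1
    linarith
  · have := mul_lt_mul_of_pos_left hq.2.1 hpos
    linarith
  · have := mul_le_mul_of_nonneg_left hq.2.2 hpos.le
    linarith

theorem rescale_le {p q r : ℝ × ℝ} (hp : p.1 ≤ p.2) (h : q.2 ≤ r.1) :
    (rescale p q).2 ≤ (rescale p r).1 := by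
  have := mul_le_mul_of_nonneg_left h (sub_nonneg.2 hp)
  simp only [rescale]
  linarith

theorem init_mem {m : ℕ} {c : Fin (m + 1) → ℝ × ℝ} (hc : c ∈ intervalSet (m + 1)) :
    (fun i : Fin m => c i.castSucc) ∈ intervalSet m :=
  ⟨fun _ => hc.1 _, fun _ _ h => hc.2 _ _ (Fin.castSucc_lt_castSucc_iff.2 h)⟩

variable [CartesianMonoidalCategory P.FullSubcategory]

/-- The composition of little intervals: the intervals of the `i`-th factor of `d` are composed
with the `i`-th interval of `c`, and the resulting lists are concatenated. -/
def composeFun : {m : ℕ} → (j : Arities m) → (Fin m → ℝ × ℝ) →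
    (tensorFam (intervals P) j).obj → Fin j.sum → ℝ × ℝ
  | _, .nil, _, _ => Fin.elim0
  | m + 1, .snoc j a, c, d =>
      Fin.append
        (composeFun j (fun i => c i.castSucc)
          ((fst (tensorFam (intervals P) j) (intervals P a)).hom d))
        (fun i => rescale (c (Fin.last m))
          (endpoints ((snd (tensorFam (intervals P) j) (intervals P a)).hom d) i))

theorem composeFun_bounds : {m : ℕ} → (j : Arities m) → (c : Fin m → ℝ × ℝ) →
    (hc : c ∈ intervalSet m) → (d : (tensorFam (intervals P) j).obj) → (i : Fin j.sum) →
    ∃ k, (c k).1 ≤ (composeFun P j c d i).1 ∧ (composeFun P j c d i).2 ≤ (c k).2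
  | _, .nil, _, _, _, i => i.elim0
  | m + 1, .snoc j a, c, hc, d, i => by
    refine Fin.addCases (fun i => ?_) (fun i => ?_) i
    · obtain ⟨k, hk⟩ := composeFun_bounds j (fun i => c i.castSucc) (init_mem hc)
        ((fst (tensorFam (intervals P) j) (intervals P a)).hom d) i
      refine ⟨k.castSucc, ?_⟩
      simpa only [composeFun, Fin.append_left] using hk
    · refine ⟨Fin.last m, ?_⟩
      have h := rescale_mem (hc.1 (Fin.last m))
        ((endpoints_mem ((snd (tensorFam (intervals P) j) (intervals P a)).hom d)).1 i)
      simpa only [composeFun, Fin.append_right] using ⟨h.1, h.2.2⟩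

theorem composeFun_mem : {m : ℕ} → (j : Arities m) → (c : Fin m → ℝ × ℝ) →
    (hc : c ∈ intervalSet m) → (d : (tensorFam (intervals P) j).obj) →
    composeFun P j c d ∈ intervalSet j.sum
  | _, .nil, _, _, _ => ⟨fun i => i.elim0, fun i => i.elim0⟩
  | m + 1, .snoc j a, c, hc, d => by
    have hd := endpoints_mem ((snd (tensorFam (intervals P) j) (intervals P a)).hom d)
    have ih := composeFun_mem j (fun i => c i.castSucc) (init_mem hc)
      ((fst (tensorFam (intervals P) j) (intervals P a)).hom d)
    have hl := hc.1 (Fin.last m)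
    constructor
    · refine fun i => Fin.addCases (fun i => ?_) (fun i => ?_) i
      · simpa only [composeFun, Fin.append_left] using ih.1 i
      · have h := rescale_mem hl (hd.1 i)
        simpa only [composeFun, Fin.append_right] using
          ⟨hl.1.trans h.1, h.2.1, h.2.2.trans hl.2.2⟩
    · refine fun i k => Fin.addCases (fun i => ?_) (fun i => ?_) i <;>
        refine Fin.addCases (fun k => ?_) (fun k => ?_) k <;> intro hik
      · simpa only [composeFun, Fin.append_left] using ih.2 i k hik
      · obtain ⟨l, hl'⟩ := composeFun_bounds P j (fun i => c i.castSucc) (init_mem hc)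
          ((fst (tensorFam (intervals P) j) (intervals P a)).hom d) i
        have h1 := hc.2 l.castSucc (Fin.last m) (Fin.castSucc_lt_last l)
        have h := rescale_mem hl (hd.1 k)
        simpa only [composeFun, Fin.append_left, Fin.append_right] using
          hl'.2.trans (h1.trans h.1)
      · have hlt : j.sum + i.val < k.val := hik
        exact absurd hlt (by have := k.isLt; omega)
      · have h := rescale_le hl.2.1.le (hd.2 i k
          (Nat.lt_of_add_lt_add_left (n := j.sum) hik))
        simpa only [composeFun, Fin.append_right] using h

theorem continuous_composeFun {T : Type*} [TopologicalSpace T] : {m : ℕ} → (j : Arities m) →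
    (c : T → Fin m → ℝ × ℝ) → Continuous c → (d : T → (tensorFam (intervals P) j).obj) →
    Continuous d → Continuous fun t => composeFun P j (c t) (d t)
  | _, .nil, _, _, _, _ => continuous_const
  | m + 1, .snoc j a, c, hc, d, hd => by
    have ih := continuous_composeFun j (fun t i => c t i.castSucc) (by fun_prop)
      (fun t => (fst (tensorFam (intervals P) j) (intervals P a)).hom (d t))
      ((fst (tensorFam (intervals P) j) (intervals P a)).hom.hom.continuous.comp hd)
    have he : Continuous fun t =>
        endpoints ((snd (tensorFam (intervals P) j) (intervals P a)).hom (d t)) :=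
      continuous_endpoints.comp
        ((snd (tensorFam (intervals P) j) (intervals P a)).hom.hom.continuous.comp hd)
    refine continuous_pi fun i => Fin.addCases (fun i => ?_) (fun i => ?_) i
    · simp only [composeFun, Fin.append_left]
      exact (continuous_apply i).comp ih
    · simp only [composeFun, Fin.append_right, rescale]
      fun_prop

/-- The non-symmetric operad of little intervals (little `1`-cubes), with all operations
numbered in the natural order of the subintervals. -/
def littleIntervals : OperadData P.FullSubcategory where
  obj := intervals P
  one := constMap (ULift.up ⟨fun _ => (0, 1), by
    refine ⟨fun _ => by norm_num, fun i k h => ?_⟩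
    exact absurd h (by rw [Subsingleton.elim i k]; exact lt_irrefl k)⟩)
  comp {m} j := ObjectProperty.homMk (TopCat.ofHom
    { toFun := fun p => ULift.up
        ⟨composeFun P j
          (endpoints ((fst (intervals P m) (tensorFam (intervals P) j)).hom p))
          ((snd (intervals P m) (tensorFam (intervals P) j)).hom p),
         composeFun_mem P j _ (endpoints_mem _) _⟩
      continuous_toFun := by
        refine continuous_uliftUp.comp (Continuous.subtype_mk ?_ _)
        exact continuous_composeFun P j _
          (continuous_endpoints.comp
            (fst (intervals P m) (tensorFam (intervals P) j)).hom.hom.continuous) _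
          (snd (intervals P m) (tensorFam (intervals P) j)).hom.hom.continuous })

/-- The identification `1 ≅ C(0)` of the one-point space with the space of empty lists. -/
def emptyIntervals : 𝟙_ P.FullSubcategory ⟶ intervals P 0 :=
  constMap (ULift.up ⟨Fin.elim0, fun i => i.elim0, fun i => i.elim0⟩)

end Spaces

/-! ## Algebras over little intervals in an enriched category, and homotopies -/

section Enriched

variable {P : ObjectProperty TopCat.{w}} [ContainsConvexSets P]
  [CartesianMonoidalCategory P.FullSubcategory]
  {M : Type u} [Category.{v} M] [MonoidalCategory M]
  (L : P.FullSubcategory ⥤ M) [L.Monoidal]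

/-- The unit map `1 ≅ L(1) ≅ L(C(0)) ≅ L(C(0)) ⊗ A^(0) ⟶ A` of an algebra over `L C`. -/
def algebraUnit [SymmetricCategory M] (A : OperadAlgebra ((littleIntervals P).map L)) :
    𝟙_ M ⟶ A.X :=
  Functor.LaxMonoidal.ε L ≫ L.map (emptyIntervals P) ≫ (ρ_ (L.obj (intervals P 0))).inv ≫ A.act 0

/-- The inclusion `X ≅ X ⊗ L(1) ⟶ X ⊗ L([0, 1])` at a point `t` of the unit interval. -/
def inclAt (X : M) (t : Set.Icc (0 : ℝ) 1) : X ⟶ X ⊗ L.obj (unitInterval P) :=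
  (ρ_ X).inv ≫ X ◁ (Functor.LaxMonoidal.ε L ≫
    L.map (constMap (Y := unitInterval P) (ULift.up t)))

/-- A homotopy from `f` to `g`: a map `X ⊗ L([0, 1]) ⟶ Y` which restricts to `f` and `g`. -/
def Homotopic {X Y : M} (f g : X ⟶ Y) : Prop :=
  ∃ H : X ⊗ L.obj (unitInterval P) ⟶ Y, inclAt L X 0 ≫ H = f ∧ inclAt L X 1 ≫ H = g

/-- `f` is a homotopy equivalence with respect to the tensors with spaces given by `L`. -/
def IsHomotopyEquivalence {X Y : M} (f : X ⟶ Y) : Prop :=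
  ∃ g : Y ⟶ X, Homotopic L (f ≫ g) (𝟙 X) ∧ Homotopic L (g ≫ f) (𝟙 Y)

end Enriched

end LittleIntervals

end

/-!
The summands `O(m + 1) ⊗ A^(m)` of the enveloping algebra form a graded monoid under composition
in the last input, and this graded monoid acts on `A`. Multiplying two defining relations gives a
defining relation again, and operad units give relations whose two sides are both the identity;
hence each factor of the multiplication can be divided by the relations separately. As `⊗`
preserves colimits in each variable, multiplication, unit and action descend to `env A`.

The orbit map of the unit of `A` forgets the last interval. Its homotopy inverse sends `a` to the
pair `[0, 1/2], [1/2, 1]` with `a` placed in the first half. The composite on `env A` therefore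
moves all intervals but the last into `[0, 1/2]` by halving them and replaces the last one by
`[1/2, 1]`. The straight line from this configuration to the original one stays inside the space
of little intervals, and it is compatible with composition in all inputs but the last because
halving is affine; so it descends to a homotopy on `env A`. The composite on `A` is the action of
`[0, 1/2]`, which the path `[0, (1 + t)/2]` joins to the unit of the operad.
-/

noncomputable section

namespace LittleIntervals

/-! ## Concatenation of tuples -/

namespace Arities

/-- Concatenation of tuples. -/
def append {m : ℕ} (j : Arities m) : {n : ℕ} → Arities n → Arities (m + n)
  | _, nil => j
  | _, snoc k a => snoc (j.append k) a

theorem sum_append {m : ℕ} (j : Arities m) : {n : ℕ} → (k : Arities n) →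
    (j.append k).sum = j.sum + k.sum
  | _, nil => rfl
  | _, snoc k a => (congrArg (· + a) (sum_append j k)).trans (Nat.add_assoc _ _ _)

end Arities

section Casts

variable {C : Type u} [Category.{v} C]

/-- The identification of two members of a family of objects with equal indices. -/
def castObj (F : ℕ → C) {m n : ℕ} (h : m = n) : F m ⟶ F n := eqToHom (congrArg F h)

@[simp] theorem castObj_rfl (F : ℕ → C) {m : ℕ} (h : m = m) : castObj F h = 𝟙 _ := rfl

@[simp]
theorem castObj_trans (F : ℕ → C) {m n k : ℕ} (h : m = n) (h' : n = k) :
    castObj F h ≫ castObj F h' = castObj F (h.trans h') := by subst h h'; simp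

end Casts

section Tuples

variable {C : Type u} [Category.{v} C] [MonoidalCategory C]

theorem castObj_tensorPow_succ (X : C) {m n : ℕ} (h : m = n) (h' : m + 1 = n + 1) :
    castObj (tensorPow X) h' = castObj (tensorPow X) h ▷ X := by
  subst h; exact (id_whiskerRight _ _).symm

theorem castObj_tensorHom_tensorPowAdd (X : C) {a a' b b' : ℕ} (ha : a = a') (hb : b = b') :
    (castObj (tensorPow X) ha ⊗ₘ castObj (tensorPow X) hb) ≫ tensorPowAdd X a' b' =
      tensorPowAdd X a b ≫ castObj (tensorPow X) (by rw [ha, hb]) := by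
  subst ha hb; simp

theorem tensorPowAdd_assoc (X : C) (a b : ℕ) : (c : ℕ) →
    tensorPowAdd X a b ▷ tensorPow X c ≫ tensorPowAdd X (a + b) c =
      (α_ _ _ _).hom ≫ tensorPow X a ◁ tensorPowAdd X b c ≫ tensorPowAdd X a (b + c) ≫
        castObj (tensorPow X) (Nat.add_assoc a b c).symm
  | 0 => by dsimp only [tensorPowAdd, tensorPow, castObj_rfl, Nat.add_zero]; simp
  | c + 1 => by
    have ih := tensorPowAdd_assoc X a b c
    rw [castObj_tensorPow_succ X (Nat.add_assoc a b c).symm]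
    change tensorPowAdd X a b ▷ (tensorPow X c ⊗ X) ≫ (α_ _ _ _).inv ≫
      tensorPowAdd X (a + b) c ▷ X = (α_ _ _ (tensorPow X c ⊗ X)).hom ≫
        tensorPow X a ◁ ((α_ _ _ _).inv ≫ tensorPowAdd X b c ▷ X) ≫
          ((α_ _ (tensorPow X (b + c)) X).inv ≫ tensorPowAdd X a (b + c) ▷ X) ≫
            castObj (tensorPow X) (Nat.add_assoc a b c).symm ▷ X
    rw [associator_inv_naturality_left_assoc, ← comp_whiskerRight, ih]
    simp

theorem tensorPowAdd_zero_left (X : C) : (n : ℕ) →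
    tensorPowAdd X 0 n = (λ_ _).hom ≫ castObj (tensorPow X) (Nat.zero_add n).symm
  | 0 => by dsimp only [tensorPowAdd, tensorPow, castObj_rfl]; simp [unitors_equal]
  | n + 1 => by
    rw [castObj_tensorPow_succ X (Nat.zero_add n).symm]
    dsimp only [tensorPowAdd, tensorPow]
    simp [tensorPowAdd_zero_left X n]

/-- The canonical isomorphism `X ⟶ X^(1)`. -/
def toPowOne (X : C) : X ⟶ tensorPow X 1 := (λ_ X).inv

theorem tensorPowAdd_one (X : C) (m : ℕ) :
    tensorPowAdd X m 1 = tensorPow X m ◁ (λ_ X).hom :=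
  triangle_assoc_comp_right (tensorPow X m) X

theorem castObj_tensorHom_tensorPowAdd_one (X : C) {m n : ℕ} (h : m = n) :
    (castObj (tensorPow X) h ⊗ₘ toPowOne X) ≫ tensorPowAdd X n 1 =
      (castObj (tensorPow X) (congrArg (· + 1) h) : tensorPow X (m + 1) ⟶ _) := by
  subst h
  rw [tensorPowAdd_one, castObj_rfl, id_tensorHom]
  exact whiskerLeft_inv_hom (tensorPow X m) (λ_ X)

/-- The canonical isomorphism `(X j₁ ⊗ ⋯ ⊗ X j_m) ⊗ (X k₁ ⊗ ⋯ ⊗ X k_n) ⟶ X j₁ ⊗ ⋯ ⊗ X k_n`. -/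
def tensorFamAppend (X : ℕ → C) {m : ℕ} (j : Arities m) : {n : ℕ} → (k : Arities n) →
    (tensorFam X j ⊗ tensorFam X k ⟶ tensorFam X (j.append k))
  | _, .nil => (ρ_ (tensorFam X j)).hom
  | _, .snoc k a =>
      (α_ (tensorFam X j) (tensorFam X k) (X a)).inv ≫ tensorFamAppend X j k ▷ X a

theorem tensorFamAppend_tensorFamToPow {X : ℕ → C} {Y : C} (f : ∀ n, X n ⟶ Y) {m : ℕ}
    (j : Arities m) : {n : ℕ} → (k : Arities n) →
      tensorFamAppend X j k ≫ tensorFamToPow f (j.append k) =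
        (tensorFamToPow f j ⊗ₘ tensorFamToPow f k) ≫ tensorPowAdd Y m n
  | _, .nil => by
    dsimp only [tensorFamAppend, tensorFamToPow, tensorPowAdd, tensorFam, tensorPow,
      Arities.append, Nat.add_zero]
    simp
  | _, .snoc (m := n) k a => by
    have ih := tensorFamAppend_tensorFamToPow f j k
    change ((α_ _ _ _).inv ≫ tensorFamAppend X j k ▷ X a) ≫
        (tensorFamToPow f (j.append k) ⊗ₘ f a) =
      (tensorFamToPow f j ⊗ₘ tensorFamToPow f k ⊗ₘ f a) ≫ (α_ _ _ _).inv ≫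
        tensorPowAdd Y m n ▷ Y
    rw [associator_inv_naturality_assoc, Category.assoc, whiskerRight_comp_tensorHom, ih,
      ← tensorHom_comp_whiskerRight]

theorem tensorFamAppend_tensorPowFlatten (X : C) {m : ℕ} (j : Arities m) :
    {n : ℕ} → (k : Arities n) →
      tensorFamAppend (tensorPow X) j k ≫ tensorPowFlatten X (j.append k) =
        (tensorPowFlatten X j ⊗ₘ tensorPowFlatten X k) ≫ tensorPowAdd X j.sum k.sum ≫
          castObj (tensorPow X) (Arities.sum_append j k).symm
  | _, .nil => by
    dsimp only [tensorFamAppend, tensorPowFlatten, tensorPowAdd, tensorFam, tensorPow,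
      Arities.append, Arities.sum, Nat.add_zero]
    simp only [rightUnitor_naturality_assoc, tensorHom_id]
    exact congrArg _ (Category.comp_id _).symm
  | _, .snoc k a => by
    have ih := tensorFamAppend_tensorPowFlatten X j k
    have assoc := tensorPowAdd_assoc X j.sum k.sum a
    have cast_add := castObj_tensorHom_tensorPowAdd X (Arities.sum_append j k).symm (rfl : a = a)
    change ((α_ _ _ _).inv ≫ tensorFamAppend (tensorPow X) j k ▷ tensorPow X a) ≫
        tensorPowFlatten X (j.append k) ▷ tensorPow X a ≫ tensorPowAdd X (j.append k).sum a =
      (tensorPowFlatten X j ⊗ₘ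
        (tensorPowFlatten X k ▷ tensorPow X a ≫ tensorPowAdd X k.sum a)) ≫
          tensorPowAdd X j.sum (k.sum + a) ≫ castObj (tensorPow X) _
    rw [Category.assoc, ← comp_whiskerRight_assoc, ih]
    simp only [castObj_rfl, tensorHom_id] at cast_add
    simp only [comp_whiskerRight, Category.assoc, cast_add, reassoc_of% assoc, castObj_trans]
    rw [← tensorHom_comp_whiskerLeft_assoc, ← tensorHom_id, associator_naturality_assoc]
    simp

/-- The map `A^(n) ⟶ Z 1 ⊗ ⋯ ⊗ Z 1` given by a map `A ⟶ Z 1` in every factor. -/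
def powToFam {A : C} {Z : ℕ → C} (e : A ⟶ Z 1) :
    (n : ℕ) → (tensorPow A n ⟶ tensorFam Z (Arities.ones n))
  | 0 => 𝟙 (𝟙_ C)
  | n + 1 => powToFam e n ⊗ₘ e

theorem powToFam_tensorFamToPow {A : C} {Z : ℕ → C} (e : A ⟶ Z 1) (f : ∀ n, Z n ⟶ A)
    (h : e ≫ f 1 = 𝟙 A) : (n : ℕ) → powToFam e n ≫ tensorFamToPow f (Arities.ones n) = 𝟙 _
  | 0 => Category.id_comp _
  | n + 1 => by
    have ih := powToFam_tensorFamToPow e f h n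
    dsimp only [powToFam, tensorFamToPow, Arities.ones, tensorPow, tensorFam]
    rw [tensorHom_comp_tensorHom, h, ih, id_tensorHom_id]

end Tuples

section Braided

variable {C : Type u} [Category.{v} C] [MonoidalCategory C] [BraidedCategory C]

theorem leftUnitor_inv_tensorHom_tensorμ (X Y : C) :
    ((λ_ X).inv ⊗ₘ (λ_ Y).inv) ≫ tensorμ (𝟙_ C) X (𝟙_ C) Y =
      (λ_ (X ⊗ Y)).inv ≫ (λ_ (𝟙_ C)).inv ▷ (X ⊗ Y) := by
  rw [← cancel_mono ((λ_ (𝟙_ C)).hom ▷ (X ⊗ Y) ≫ (λ_ (X ⊗ Y)).hom)]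
  simp only [Category.assoc, ← leftUnitor_monoidal]
  simp

theorem tensorμ_tensorUnit_third (X Y Z : C) :
    tensorμ X Y (𝟙_ C) Z =
      (X ⊗ Y) ◁ (λ_ Z).hom ≫ (α_ X Y Z).hom ≫ (ρ_ X).inv ▷ (Y ⊗ Z) := by
  simp only [tensorμ, braiding_tensorUnit_right]
  monoidal

theorem tensorμ_whiskerRight_associator (X Y Z W V : C) :
    tensorμ X Y Z W ▷ V ≫ (α_ _ _ _).hom ≫ (X ⊗ Z) ◁ (α_ Y W V).hom =
      (α_ _ _ _).hom ≫ (X ⊗ Y) ◁ (α_ Z W V).hom ≫ tensorμ X Y Z (W ⊗ V) := by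
  simp only [tensorμ]
  monoidal

theorem tensorμ_whiskerLeft_leftUnitor_inv (X Y Z W : C) :
    tensorμ X Y Z W ≫ (X ◁ (λ_ Z).inv) ▷ (Y ⊗ W) ≫ (α_ _ _ _).hom =
      (α_ _ _ _).hom ≫ X ◁ (λ_ Y).inv ▷ (Z ⊗ W) ≫ X ◁ tensorμ (𝟙_ C) Y Z W := by
  simp only [tensorμ]
  monoidal

theorem tensorμ_leftUnitor_inv_tensorHom {X Y Z W T V : C} (f : 𝟙_ C ⟶ T) (g : Y ⟶ V) :
    tensorμ X Y Z W ≫ (X ◁ ((λ_ Z).inv ≫ f ▷ Z) ⊗ₘ g ▷ W) =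
      (α_ X Y (Z ⊗ W)).hom ≫ X ◁ (((λ_ Y).inv ≫ (f ⊗ₘ g)) ▷ (Z ⊗ W) ≫ tensorμ T V Z W) ≫
        (α_ _ _ _).inv := by
  rw [comp_whiskerRight, Category.assoc, tensorμ_natural_left]
  simp only [MonoidalCategory.whiskerLeft_comp, Category.assoc]
  rw [← reassoc_of% tensorμ_whiskerLeft_leftUnitor_inv, ← whiskerRight_comp_tensorHom,
    ← id_tensorHom X (_ ⊗ₘ _), ← id_tensorHom X (f ▷ Z), associator_inv_naturality,
    Iso.hom_inv_id_assoc]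

theorem tensorμ_tensorHom_associator_inv {X₁ X₂ X₃ Y₁ Y₂ Y₃ Z U W V : C} (c : X₁ ⊗ Y₁ ⟶ Z)
    (a : X₂ ⊗ Y₂ ⟶ U) (q : X₃ ⊗ Y₃ ⟶ W) (f : Z ⊗ U ⟶ V) :
    tensorμ X₁ (X₂ ⊗ X₃) Y₁ (Y₂ ⊗ Y₃) ≫ (c ⊗ₘ (tensorμ X₂ X₃ Y₂ Y₃ ≫ (a ⊗ₘ q))) ≫
        (α_ Z U W).inv ≫ f ▷ W =
      ((α_ X₁ X₂ X₃).inv ⊗ₘ (α_ Y₁ Y₂ Y₃).inv) ≫ tensorμ (X₁ ⊗ X₂) X₃ (Y₁ ⊗ Y₂) Y₃ ≫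
        ((tensorμ X₁ X₂ Y₁ Y₂ ≫ (c ⊗ₘ a) ≫ f) ⊗ₘ q) := by
  rw [← whiskerLeft_comp_tensorHom, Category.assoc, associator_inv_naturality_assoc,
    tensorHom_comp_whiskerRight, ← whiskerRight_comp_tensorHom,
    ← cancel_epi ((α_ X₁ X₂ X₃).hom ⊗ₘ (α_ Y₁ Y₂ Y₃).hom),
    ← reassoc_of% associator_monoidal X₁ X₂ X₃ Y₁ Y₂ Y₃]
  simp only [Iso.hom_inv_id, Iso.hom_inv_id_assoc, tensorHom_comp_tensorHom_assoc,
    id_tensorHom_id, Category.id_comp, whiskerRight_comp_tensorHom]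

theorem tensorμ_tensorHom_of_unit {X Z W T V : C} (f : 𝟙_ C ⟶ X) (c : X ⊗ Z ⟶ T)
    (q : 𝟙_ C ⊗ W ⟶ V) :
    ((λ_ (𝟙_ C)).inv ≫ (f ⊗ₘ 𝟙 (𝟙_ C))) ▷ (Z ⊗ W) ≫ tensorμ X (𝟙_ C) Z W ≫ (c ⊗ₘ q) =
      (λ_ (Z ⊗ W)).hom ≫ (((λ_ Z).inv ≫ f ▷ Z ≫ c) ⊗ₘ ((λ_ W).inv ≫ q)) := by
  rw [comp_whiskerRight_assoc, tensorμ_natural_left_assoc, tensorHom_comp_tensorHom,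
    id_whiskerRight, Category.id_comp, tensor_left_unitality, Category.assoc, Category.assoc,
    tensorHom_comp_tensorHom, Iso.hom_inv_id_assoc, Iso.hom_inv_id_assoc]

theorem tensorFamAppend_unshuffle (X Y : ℕ → C) {m : ℕ} (j : Arities m) :
    {n : ℕ} → (k : Arities n) →
      tensorFamAppend (fun n => X n ⊗ Y n) j k ≫ unshuffle X Y (j.append k) =
        (unshuffle X Y j ⊗ₘ unshuffle X Y k) ≫ tensorμ _ _ _ _ ≫
          (tensorFamAppend X j k ⊗ₘ tensorFamAppend Y j k)
  | _, .nil => by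
    dsimp only [tensorFamAppend, unshuffle, tensorFam, Arities.append]
    rw [← rightUnitor_naturality, tensor_right_unitality (tensorFam X j) (tensorFam Y j),
      MonoidalCategory.tensorHom_def (unshuffle X Y j), Category.assoc]
  | _, .snoc k a => by
    have ih := tensorFamAppend_unshuffle X Y j k
    have assoc := tensor_associativity (tensorFam X j) (tensorFam Y j) (tensorFam X k)
      (tensorFam Y k) (X a) (Y a)
    dsimp only [tensorFamAppend, unshuffle, tensorFam, Arities.append]
    rw [← tensorHom_comp_tensorHom, ← cancel_epi (α_ _ _ _).hom]
    simp only [Category.assoc, Iso.hom_inv_id_assoc]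
    rw [← comp_whiskerRight_assoc, ih]
    simp only [comp_whiskerRight, Category.assoc]
    rw [tensorμ_natural_left, ← tensorHom_comp_whiskerLeft_assoc,
      ← tensorHom_id (unshuffle X Y k), ← associator_naturality_assoc, ← reassoc_of% assoc]
    simp

/-- The map `(X j₁ ⊗ A^(j₁)) ⊗ ⋯ ⊗ (X j_m ⊗ A^(j_m)) ⟶ (X j₁ ⊗ ⋯ ⊗ X j_m) ⊗ A^(j₁ + ⋯ + j_m)`. -/
def regroup (X : ℕ → C) (A : C) {m : ℕ} (j : Arities m) :
    tensorFam (fun n => X n ⊗ tensorPow A n) j ⟶ tensorFam X j ⊗ tensorPow A j.sum :=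
  unshuffle X (tensorPow A) j ≫ tensorFam X j ◁ tensorPowFlatten A j

theorem regroup_snoc (X : ℕ → C) (A : C) {m : ℕ} (j : Arities m) (a : ℕ) :
    regroup X A (j.snoc a) = regroup X A j ▷ (X a ⊗ tensorPow A a) ≫ tensorμ _ _ _ _ ≫
      (tensorFam X j ⊗ X a) ◁ tensorPowAdd A j.sum a := by
  have naturality :=
    tensorμ_natural_left (𝟙 (tensorFam X j)) (tensorPowFlatten A j) (X a) (tensorPow A a)
  simp only [id_tensorHom, id_whiskerRight] at naturality
  simp only [regroup, comp_whiskerRight, Category.assoc]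
  rw [reassoc_of% naturality, ← MonoidalCategory.whiskerLeft_comp]
  exact Category.assoc _ _ _

theorem tensorFamAppend_regroup (X : ℕ → C) (A : C) {m n : ℕ} (j : Arities m) (k : Arities n) :
    tensorFamAppend (fun n => X n ⊗ tensorPow A n) j k ≫ regroup X A (j.append k) =
      (regroup X A j ⊗ₘ regroup X A k) ≫ tensorμ _ _ _ _ ≫
        (tensorFamAppend X j k ⊗ₘ (tensorPowAdd A j.sum k.sum ≫
          castObj (tensorPow A) (Arities.sum_append j k).symm)) := by
  simp only [regroup]
  rw [reassoc_of% tensorFamAppend_unshuffle X (tensorPow A) j k, ← tensorHom_comp_tensorHom_assoc,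
    ← id_tensorHom, ← id_tensorHom, ← id_tensorHom, tensorμ_natural_assoc, id_tensorHom,
    tensorHom_comp_whiskerLeft, tensorHom_comp_tensorHom, tensorFamAppend_tensorPowFlatten,
    id_tensorHom_id, Category.id_comp]

/-- The map `A ≅ 1 ⊗ A^(1) ⟶ O(1) ⊗ A^(1)` given by the unit of the operad. -/
def insertOne (O : OperadData C) (A : C) : A ⟶ O.obj 1 ⊗ tensorPow A 1 :=
  (λ_ A).inv ≫ (O.one ⊗ₘ toPowOne A)

theorem whiskerLeft_insertOne_tensorμ (O : OperadData C) (A X Y : C) :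
    (X ⊗ Y) ◁ insertOne O A ≫ tensorμ X Y (O.obj 1) (tensorPow A 1) ≫
        (X ⊗ O.obj 1) ◁ Y ◁ (λ_ A).hom =
      (α_ X Y A).hom ≫ ((ρ_ X).inv ≫ X ◁ O.one) ▷ (Y ⊗ A) := by
  have cancel : Y ◁ toPowOne A ≫ Y ◁ (λ_ A).hom = 𝟙 (Y ⊗ A) := whiskerLeft_inv_hom Y (λ_ A)
  rw [insertOne, MonoidalCategory.whiskerLeft_comp_assoc, tensorμ_natural_right_assoc,
    tensorμ_tensorUnit_third, tensorHom_comp_whiskerLeft, cancel, tensorHom_id]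
  monoidal

theorem powToFam_regroup (O : OperadData C) (A : C) : (n : ℕ) →
    powToFam (Z := fun n => O.obj n ⊗ tensorPow A n) (insertOne O A) n ≫
      regroup O.obj A (Arities.ones n) =
    (λ_ _).inv ≫ (O.oneFam n ⊗ₘ castObj (tensorPow A) (Arities.sum_ones n).symm)
  | 0 => by
    change 𝟙 (𝟙_ C) ≫ (λ_ (𝟙_ C)).inv ≫ 𝟙_ C ◁ 𝟙 (𝟙_ C) = (λ_ (𝟙_ C)).inv ≫ (𝟙 (𝟙_ C) ⊗ₘ 𝟙 (𝟙_ C))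
    simp
  | n + 1 => by
    have ih := powToFam_regroup O A n
    have append_one := castObj_tensorHom_tensorPowAdd_one A (Arities.sum_ones n).symm
    have regroup_insert :
        (powToFam (Z := fun n => O.obj n ⊗ tensorPow A n) (insertOne O A) n ⊗ₘ insertOne O A) ≫
          regroup O.obj A (Arities.ones n) ▷ _ ≫ tensorμ _ _ _ _ ≫
            (tensorFam O.obj (Arities.ones n) ⊗ O.obj 1) ◁ tensorPowAdd A _ 1 =
        (λ_ _).inv ≫ (((λ_ _).inv ≫ (O.oneFam n ⊗ₘ O.one)) ⊗ₘ
          ((castObj (tensorPow A) (Arities.sum_ones n).symm ⊗ₘ toPowOne A) ≫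
            tensorPowAdd A (Arities.ones n).sum 1)) := by
      rw [tensorHom_comp_whiskerRight_assoc, ih, insertOne,
        ← tensorHom_comp_tensorHom_assoc, tensorμ_natural_assoc,
        reassoc_of% leftUnitor_inv_tensorHom_tensorμ, tensorHom_comp_whiskerLeft,
        whiskerRight_comp_tensorHom]
    rw [append_one] at regroup_insert
    exact (congrArg (_ ≫ ·) (regroup_snoc O.obj A (Arities.ones n) 1)).trans regroup_insert

end Braided

namespace OperadData

variable {C : Type u} [Category.{v} C] [MonoidalCategory C] (O : OperadData C)

/-- The composition `Γ`, with source unfolded: the last of the inner operations has arity `a`. -/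
def compSnoc {m : ℕ} (j : Arities m) (a : ℕ) :
    O.obj (m + 1) ⊗ (tensorFam O.obj j ⊗ O.obj a) ⟶ O.obj (j.sum + a) :=
  O.comp (j.snoc a)

/-- The partial composition `Γ(-; 1, …, 1, -) : O(m+1) ⊗ O(q) ⟶ O(m+q)` in the last input;
unlike in `compLast`, the operation in that input may be nullary. -/
def compLastOp (m q : ℕ) : O.obj (m + 1) ⊗ O.obj q ⟶ O.obj (m + q) :=
  O.obj (m + 1) ◁ ((λ_ (O.obj q)).inv ≫ O.oneFam m ▷ O.obj q) ≫
    O.compSnoc (Arities.ones m) q ≫ castObj O.obj (congrArg (· + q) (Arities.sum_ones m))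

/-- The associativity and unit laws of an operad which concern the composition in the last input
of an operation. -/
structure LastInputLaws [BraidedCategory C] : Prop where
  one_compLast (n : ℕ) : O.one ▷ O.obj (n + 1) ≫ O.compLast 0 n =
    (λ_ (O.obj (n + 1))).hom ≫ castObj O.obj (congrArg (· + 1) (Nat.zero_add n).symm)
  compLast_one (m : ℕ) : O.obj (m + 1) ◁ O.one ≫ O.compLast m 0 = (ρ_ (O.obj (m + 1))).hom
  compLast_assoc (m n p : ℕ) : O.compLast m n ▷ O.obj (p + 1) ≫ O.compLast (m + n) p =
    (α_ _ _ _).hom ≫ O.obj (m + 1) ◁ O.compLast n p ≫ O.compLast m (n + p) ≫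
      castObj O.obj (congrArg (· + 1) (Nat.add_assoc m n p).symm)
  compOne_append {m n : ℕ} (j : Arities m) (k : Arities n) :
    tensorμ _ _ _ _ ≫ (O.compLast m n ⊗ₘ tensorFamAppend O.obj j k) ≫ O.compOne (j.append k) =
      (O.compOne j ⊗ₘ O.compOne k) ≫ O.compLast j.sum k.sum ≫
        castObj O.obj (congrArg (· + 1) (Arities.sum_append j k).symm)
  compOne_ones (m : ℕ) : O.obj (m + 1) ◁ O.oneFam m ≫ O.compOne (Arities.ones m) =
    (ρ_ (O.obj (m + 1))).hom ≫ castObj O.obj (congrArg (· + 1) (Arities.sum_ones m).symm)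

end OperadData

/-! ## The monoid structure of the enveloping algebra -/

namespace OperadAlgebra

variable {M : Type u} [Category.{v} M] [MonoidalCategory M] [SymmetricCategory M]
  {O : OperadData M} (A : OperadAlgebra O)

/-- The action map `ξ_{m+1}`, with source unfolded: the last element of `A` is split off. -/
def actSucc (m : ℕ) : O.obj (m + 1) ⊗ (tensorPow A.X m ⊗ A.X) ⟶ A.X := A.act (m + 1)

theorem insertOne_act : insertOne O A.X ≫ A.act 1 = 𝟙 A.X := by
  rw [insertOne, MonoidalCategory.tensorHom_def, Category.assoc, Category.assoc,
    Iso.inv_comp_eq, Category.comp_id]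
  exact A.act_one

theorem powToFam_insertOne_act (m : ℕ) :
    powToFam (Z := fun n => O.obj n ⊗ tensorPow A.X n) (insertOne O A.X) m ≫
      tensorFamToPow A.act (Arities.ones m) = 𝟙 _ :=
  powToFam_tensorFamToPow _ A.act A.insertOne_act m

theorem castObj_whiskerRight_act {m n : ℕ} (h : m = n) :
    castObj O.obj h ▷ tensorPow A.X n ≫ A.act n =
      O.obj m ◁ castObj (tensorPow A.X) h.symm ≫ A.act m := by
  subst h; simp

theorem tensorFamToPow_actSucc {m : ℕ} (j : Arities m) (a : ℕ) :
    O.obj (m + 1) ◁ (tensorFamToPow A.act j ⊗ₘ A.act a) ≫ A.actSucc m =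
      O.obj (m + 1) ◁ (regroup O.obj A.X j ▷ (O.obj a ⊗ tensorPow A.X a) ≫ tensorμ _ _ _ _ ≫
          (tensorFam O.obj j ⊗ O.obj a) ◁ tensorPowAdd A.X j.sum a) ≫
        (α_ _ _ _).inv ≫ O.compSnoc j a ▷ _ ≫ A.act (j.sum + a) := by
  rw [← regroup_snoc]
  exact A.act_comp (j.snoc a)

theorem tensorFamToPow_actSucc_one {m : ℕ} (j : Arities m) :
    O.obj (m + 1) ◁ (tensorFamToPow A.act j ⊗ₘ A.act 1) ≫ A.actSucc m =
      O.obj (m + 1) ◁ (regroup O.obj A.X j ▷ (O.obj 1 ⊗ tensorPow A.X 1) ≫ tensorμ _ _ _ _ ≫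
          (tensorFam O.obj j ⊗ O.obj 1) ◁ tensorPow A.X j.sum ◁ (λ_ A.X).hom) ≫
        (α_ _ _ _).inv ≫ O.compSnoc j 1 ▷ _ ≫ A.actSucc j.sum := by
  rw [A.tensorFamToPow_actSucc j 1, tensorPowAdd_one]
  rfl

theorem whiskerLeft_act_actSucc (m q : ℕ) :
    O.obj (m + 1) ◁ tensorPow A.X m ◁ A.act q ≫ A.actSucc m =
      O.obj (m + 1) ◁ (((λ_ _).inv ≫ (O.oneFam m ⊗ₘ
          castObj (tensorPow A.X) (Arities.sum_ones m).symm)) ▷ (O.obj q ⊗ tensorPow A.X q) ≫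
            tensorμ _ _ _ _ ≫ _ ◁ tensorPowAdd A.X _ q) ≫
        (α_ _ _ _).inv ≫ O.compSnoc (Arities.ones m) q ▷ _ ≫ A.act ((Arities.ones m).sum + q) := by
  have insert_ones : tensorPow A.X m ◁ A.act q =
      powToFam (Z := fun n => O.obj n ⊗ tensorPow A.X n) (insertOne O A.X) m ▷ _ ≫
        (tensorFamToPow A.act (Arities.ones m) ⊗ₘ A.act q) := by
    rw [whiskerRight_comp_tensorHom, A.powToFam_insertOne_act, id_tensorHom]
  rw [insert_ones, MonoidalCategory.whiskerLeft_comp_assoc, tensorFamToPow_actSucc,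
    ← MonoidalCategory.whiskerLeft_comp_assoc, ← comp_whiskerRight_assoc, powToFam_regroup]

theorem compLastOp_act (m q : ℕ) :
    tensorμ (O.obj (m + 1)) (tensorPow A.X m) (O.obj q) (tensorPow A.X q) ≫
        (O.compLastOp m q ⊗ₘ tensorPowAdd A.X m q) ≫ A.act (m + q) =
      (α_ _ _ _).hom ≫ O.obj (m + 1) ◁ tensorPow A.X m ◁ A.act q ≫ A.actSucc m := by
  have cast_add := castObj_tensorHom_tensorPowAdd A.X (Arities.sum_ones m).symm (rfl : q = q)
  simp only [castObj_rfl, tensorHom_id] at cast_add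
  have insert_ones := tensorμ_leftUnitor_inv_tensorHom (X := O.obj (m + 1)) (Z := O.obj q)
    (W := tensorPow A.X q) (O.oneFam m) (castObj (tensorPow A.X) (Arities.sum_ones m).symm)
  rw [whiskerLeft_act_actSucc, ← Category.assoc (_ ▷ _),
    MonoidalCategory.whiskerLeft_comp _ (_ ≫ _) (_ ◁ _), Category.assoc,
    associator_inv_naturality_right_assoc, ← reassoc_of% insert_ones,
    tensorHom_comp_whiskerLeft_assoc, cast_add, ← tensorHom_comp_whiskerLeft_assoc,
    whisker_exchange_assoc,
    ← A.castObj_whiskerRight_act (congrArg (· + q) (Arities.sum_ones m)), OperadData.compLastOp,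
    ← tensorHom_comp_whiskerRight_assoc, comp_whiskerRight_assoc]

theorem compLast_actSucc (m n : ℕ) :
    tensorμ (O.obj (m + 1)) (tensorPow A.X m) (O.obj (n + 1)) (tensorPow A.X n ⊗ A.X) ≫
        (O.compLast m n ⊗ₘ ((α_ _ _ _).inv ≫ tensorPowAdd A.X m n ▷ A.X)) ≫ A.actSucc (m + n) =
      (α_ _ _ _).hom ≫ O.obj (m + 1) ◁ tensorPow A.X m ◁ A.actSucc n ≫ A.actSucc m :=
  A.compLastOp_act m (n + 1)

/-- The multiplication `O(m+1) ⊗ A^(m)` by `O(n+1) ⊗ A^(n)` given by `∘_{m+1}`. -/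
def summandMul (m n : ℕ) : A.envSummand m ⊗ A.envSummand n ⟶ A.envSummand (m + n) :=
  A.envMulSummand m n

/-- The map `1 ⟶ O(1) ≅ O(1) ⊗ A^(0)`, the unit of `summandMul`. -/
def summandOne : 𝟙_ M ⟶ A.envSummand 0 := O.one ≫ (ρ_ (O.obj 1)).inv

/-- The action `(O(m+1) ⊗ A^(m)) ⊗ A ⟶ A`. -/
def summandSmul (m : ℕ) : A.envSummand m ⊗ A.X ⟶ A.X :=
  (α_ (O.obj (m + 1)) (tensorPow A.X m) A.X).hom ≫ A.actSucc m

/-- The restriction of the first map of the coequalizer `env A` to the summand of `j`. -/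
def relationAct {m : ℕ} (j : Arities m) : A.envRelation ⟨m, j⟩ ⟶ A.envSummand m := A.envAct ⟨m, j⟩

/-- The restriction of the second map of the coequalizer `env A` to the summand of `j`. -/
def relationComp {m : ℕ} (j : Arities m) : A.envRelation ⟨m, j⟩ ⟶ A.envSummand j.sum :=
  A.envComp ⟨m, j⟩

theorem relationComp_eq {m : ℕ} (j : Arities m) :
    A.relationComp j =
      O.obj (m + 1) ◁ regroup O.obj A.X j ≫ (α_ _ _ _).inv ≫ O.compOne j ▷ _ := rfl

theorem castObj_envSummand {m n : ℕ} (h : m = n) : castObj A.envSummand h =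
    (castObj O.obj (congrArg (· + 1) h) ⊗ₘ castObj (tensorPow A.X) h) := by
  subst h
  exact (id_tensorHom_id _ _).symm

theorem summandMul_summandSmul (m n : ℕ) :
    A.summandMul m n ▷ A.X ≫ A.summandSmul (m + n) =
      (α_ _ _ _).hom ≫ A.envSummand m ◁ A.summandSmul n ≫ A.summandSmul m := by
  dsimp only [summandMul, envMulSummand, summandSmul, envSummand]
  rw [MonoidalCategory.whiskerLeft_comp_assoc, associator_naturality_right_assoc,
    ← compLast_actSucc, ← reassoc_of% tensorμ_whiskerRight_associator,
    ← whiskerLeft_comp_tensorHom]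
  simp only [comp_whiskerRight, Category.assoc, whiskerLeft_hom_inv_assoc]
  rw [← tensorHom_id (_ ⊗ₘ _), associator_naturality_assoc, tensorHom_id]

theorem relationAct_summandSmul {m : ℕ} (j : Arities m) :
    A.relationAct j ▷ A.X ≫ A.summandSmul m = A.relationComp j ▷ A.X ≫ A.summandSmul j.sum := by
  have insert_one : tensorFamToPow A.act j ▷ A.X =
      _ ◁ insertOne O A.X ≫ (tensorFamToPow A.act j ⊗ₘ A.act 1) := by
    rw [whiskerLeft_comp_tensorHom, A.insertOne_act, tensorHom_id]
  rw [relationComp_eq]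
  dsimp only [relationAct, envAct, summandSmul, envSummand, envRelation, OperadData.compOne]
  rw [associator_naturality_middle_assoc, insert_one, MonoidalCategory.whiskerLeft_comp_assoc,
    tensorFamToPow_actSucc_one, ← MonoidalCategory.whiskerLeft_comp_assoc, whisker_exchange_assoc,
    whiskerLeft_insertOne_tensorμ]
  change _ = (_ ≫ _ ≫ (_ ≫ O.compSnoc j 1) ▷ _) ▷ A.X ≫ _
  monoidal

theorem summandOne_eq : A.summandOne = (λ_ (𝟙_ M)).inv ≫ (O.one ⊗ₘ 𝟙 (𝟙_ M)) := by
  rw [tensorHom_id, unitors_inv_equal]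
  exact rightUnitor_inv_naturality O.one

theorem summandOne_summandMul (hO : O.LastInputLaws) (n : ℕ) :
    A.summandOne ▷ A.envSummand n ≫ A.summandMul 0 n =
      (λ_ (A.envSummand n)).hom ≫ castObj A.envSummand (Nat.zero_add n).symm := by
  rw [summandOne_eq, castObj_envSummand]
  refine (tensorμ_tensorHom_of_unit O.one (O.compLast 0 n) (tensorPowAdd A.X 0 n)).trans ?_
  rw [hO.one_compLast, tensorPowAdd_zero_left]
  exact congrArg (_ ≫ ·) (congrArg₂ _ (Iso.inv_hom_id_assoc _ _) (Iso.inv_hom_id_assoc _ _))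

theorem summandMul_summandOne (hO : O.LastInputLaws) (m : ℕ) :
    A.envSummand m ◁ A.summandOne ≫ A.summandMul m 0 = (ρ_ (A.envSummand m)).hom := by
  rw [summandOne_eq]
  change (O.obj (m + 1) ⊗ tensorPow A.X m) ◁ ((λ_ (𝟙_ M)).inv ≫ (O.one ⊗ₘ 𝟙 (𝟙_ M))) ≫
    tensorμ (O.obj (m + 1)) (tensorPow A.X m) (O.obj 1) (𝟙_ M) ≫
      (O.compLast m 0 ⊗ₘ (ρ_ (tensorPow A.X m)).hom) =
        (ρ_ (O.obj (m + 1) ⊗ tensorPow A.X m)).hom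
  rw [MonoidalCategory.whiskerLeft_comp_assoc, tensorμ_natural_right_assoc,
    tensorHom_comp_tensorHom, hO.compLast_one, MonoidalCategory.whiskerLeft_id,
    Category.id_comp, tensor_right_unitality]

theorem summandMul_assoc (hO : O.LastInputLaws) (m n p : ℕ) :
    A.summandMul m n ▷ A.envSummand p ≫ A.summandMul (m + n) p =
      (α_ _ _ _).hom ≫ A.envSummand m ◁ A.summandMul n p ≫ A.summandMul m (n + p) ≫
        castObj A.envSummand (Nat.add_assoc m n p).symm := by
  rw [castObj_envSummand]
  dsimp only [summandMul, envMulSummand, envSummand]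
  rw [comp_whiskerRight_assoc, tensorμ_natural_left_assoc, tensorHom_comp_tensorHom,
    hO.compLast_assoc, tensorPowAdd_assoc, ← tensorHom_comp_tensorHom,
    tensor_associativity_assoc, MonoidalCategory.whiskerLeft_comp_assoc, Category.assoc,
    tensorμ_natural_right_assoc]
  simp only [tensorHom_comp_tensorHom]

theorem summandOne_summandSmul : A.summandOne ▷ A.X ≫ A.summandSmul 0 = (λ_ A.X).hom := by
  have act_one : O.one ▷ A.X ≫ O.obj 1 ◁ (λ_ A.X).inv ≫ A.actSucc 0 = (λ_ A.X).hom := A.act_one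
  rw [← act_one]
  change (O.one ≫ (ρ_ (O.obj 1)).inv) ▷ A.X ≫ (α_ _ (𝟙_ M) _).hom ≫ A.actSucc 0 = _
  monoidal

/-- The multiplication of relations which covers `summandMul`. -/
def envRelationMul {m n : ℕ} (j : Arities m) (k : Arities n) :
    A.envRelation ⟨m, j⟩ ⊗ A.envRelation ⟨n, k⟩ ⟶ A.envRelation ⟨m + n, j.append k⟩ :=
  tensorμ _ _ _ _ ≫ (O.compLast m n ⊗ₘ tensorFamAppend (fun n => O.obj n ⊗ tensorPow A.X n) j k)

theorem envRelationMul_relationAct {m n : ℕ} (j : Arities m) (k : Arities n) :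
    A.envRelationMul j k ≫ A.relationAct (j.append k) =
      (A.relationAct j ⊗ₘ A.relationAct k) ≫ A.summandMul m n := by
  dsimp only [envRelationMul, relationAct, envAct, summandMul, envMulSummand, envRelation,
    envSummand]
  rw [Category.assoc, tensorHom_comp_whiskerLeft, tensorFamAppend_tensorFamToPow,
    ← id_tensorHom, ← id_tensorHom, tensorμ_natural_assoc, tensorHom_comp_tensorHom,
    id_tensorHom_id, Category.id_comp]

theorem envRelationMul_relationComp (hO : O.LastInputLaws) {m n : ℕ} (j : Arities m)
    (k : Arities n) : A.envRelationMul j k ≫ A.relationComp (j.append k) =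
      (A.relationComp j ⊗ₘ A.relationComp k) ≫ A.summandMul j.sum k.sum ≫
        castObj A.envSummand (Arities.sum_append j k).symm := by
  have regroup_naturality := tensorμ_natural (𝟙 (O.obj (m + 1))) (regroup O.obj A.X j)
    (𝟙 (O.obj (n + 1))) (regroup O.obj A.X k)
  have compOne_naturality := tensorμ_natural (O.compOne j) (𝟙 (tensorPow A.X j.sum))
    (O.compOne k) (𝟙 (tensorPow A.X k.sum))
  simp only [tensorHom_id, id_tensorHom, id_whiskerRight] at regroup_naturality compOne_naturality
  rw [castObj_envSummand, relationComp_eq, relationComp_eq, relationComp_eq]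
  dsimp only [envRelationMul, summandMul, envMulSummand, envRelation, envSummand]
  rw [Category.assoc, tensorHom_comp_whiskerLeft_assoc, tensorFamAppend_regroup,
    ← whiskerLeft_comp_tensorHom_assoc, ← reassoc_of% regroup_naturality,
    tensorμ_tensorHom_associator_inv, hO.compOne_append, ← tensorHom_comp_tensorHom_assoc,
    ← tensorHom_comp_tensorHom_assoc, Category.assoc, reassoc_of% compOne_naturality,
    tensorHom_comp_tensorHom, ← whiskerRight_comp_tensorHom]

/-- The relation with an operad unit next to each factor `A`. -/
def envRelationUnit (m : ℕ) : A.envSummand m ⟶ A.envRelation ⟨m, Arities.ones m⟩ :=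
  O.obj (m + 1) ◁ powToFam (insertOne O A.X) m

theorem envRelationUnit_relationAct (m : ℕ) :
    A.envRelationUnit m ≫ A.relationAct (Arities.ones m) = 𝟙 _ := by
  dsimp only [envRelationUnit, relationAct, envAct, envRelation, envSummand]
  rw [← MonoidalCategory.whiskerLeft_comp, A.powToFam_insertOne_act,
    MonoidalCategory.whiskerLeft_id]

theorem envRelationUnit_relationComp (hO : O.LastInputLaws) (m : ℕ) :
    A.envRelationUnit m ≫ A.relationComp (Arities.ones m) =
      castObj A.envSummand (Arities.sum_ones m).symm := by
  rw [castObj_envSummand, relationComp_eq]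
  dsimp only [envRelationUnit, envRelation, envSummand]
  rw [← MonoidalCategory.whiskerLeft_comp_assoc, powToFam_regroup,
    MonoidalCategory.tensorHom_def', MonoidalCategory.whiskerLeft_comp_assoc,
    MonoidalCategory.whiskerLeft_comp_assoc, associator_inv_naturality_middle_assoc,
    ← comp_whiskerRight, hO.compOne_ones, associator_inv_naturality_right_assoc,
    comp_whiskerRight, whisker_exchange_assoc]
  simp only [MonoidalCategory.tensorHom_def, triangle_assoc_comp_left_inv_assoc,
    inv_hom_whiskerRight_assoc]
  rw [whisker_exchange]

end OperadAlgebra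

namespace OperadAlgebra

variable {M : Type u} [Category.{v} M] [MonoidalCategory M] [SymmetricCategory M]
  {O : OperadData M} (A : OperadAlgebra O) [HasCountableColimits M]

/-- The inclusion of the summand `O(m+1) ⊗ A^(m)` into the enveloping algebra, with the source
recorded as `envSummand`. -/
def summandι (m : ℕ) : A.envSummand m ⟶ A.env := A.envι m

theorem relationAct_summandι {m : ℕ} (j : Arities m) :
    A.relationAct j ≫ A.summandι m = A.relationComp j ≫ A.summandι j.sum := by
  have condition := congrArg (Sigma.ι A.envRelation ⟨m, j⟩ ≫ ·) (coequalizer.condition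
    (Sigma.desc fun s => A.envAct s ≫ Sigma.ι A.envSummand s.1)
    (Sigma.desc fun s => A.envComp s ≫ Sigma.ι A.envSummand s.2.sum))
  simp only [Sigma.ι_desc_assoc, Category.assoc] at condition
  exact condition

theorem castObj_summandι {m n : ℕ} (h : m = n) :
    castObj A.envSummand h ≫ A.summandι n = A.summandι m := by
  subst h; simp

theorem env_hom_ext {Y : M} {f g : A.env ⟶ Y} (h : ∀ m, A.summandι m ≫ f = A.summandι m ≫ g) :
    f = g := by
  refine coequalizer.hom_ext (Sigma.hom_ext _ _ fun m => ?_)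
  exact (Category.assoc _ _ _).symm.trans ((h m).trans (Category.assoc _ _ _))

/-- The map out of the enveloping algebra induced by compatible maps on its summands. -/
def envDesc {Y : M} (k : ∀ m, A.envSummand m ⟶ Y)
    (hk : ∀ (m : ℕ) (j : Arities m), A.relationAct j ≫ k m = A.relationComp j ≫ k j.sum) :
    A.env ⟶ Y :=
  coequalizer.desc (Sigma.desc k) (Sigma.hom_ext _ _ fun s => by
    simp only [Sigma.ι_desc_assoc, Category.assoc, Sigma.ι_desc]
    exact hk s.1 s.2)

theorem summandι_envDesc {Y : M} (k : ∀ m, A.envSummand m ⟶ Y)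
    (hk : ∀ (m : ℕ) (j : Arities m), A.relationAct j ≫ k m = A.relationComp j ≫ k j.sum) (m : ℕ) :
    A.summandι m ≫ A.envDesc k hk = k m :=
  (Category.assoc _ _ _).trans
    ((congrArg (_ ≫ ·) (coequalizer.π_desc _ _)).trans (Sigma.ι_desc _ _))

section Closed

variable [MonoidalClosed M]

theorem tensor_env_hom_ext {T Y : M} {f g : T ⊗ A.env ⟶ Y}
    (h : ∀ m, T ◁ A.summandι m ≫ f = T ◁ A.summandι m ≫ g) : f = g := by
  apply MonoidalClosed.curry_injective
  refine A.env_hom_ext fun m => ?_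
  rw [← MonoidalClosed.curry_natural_left, ← MonoidalClosed.curry_natural_left, h]

/-- The map out of `T ⊗ env A` induced by compatible maps on the summands of `env A`. -/
def tensorEnvDesc {T Y : M} (k : ∀ m, T ⊗ A.envSummand m ⟶ Y)
    (hk : ∀ (m : ℕ) (j : Arities m),
      T ◁ A.relationAct j ≫ k m = T ◁ A.relationComp j ≫ k j.sum) :
    T ⊗ A.env ⟶ Y :=
  MonoidalClosed.uncurry (A.envDesc (fun m => MonoidalClosed.curry (k m)) fun _ j => by
    rw [← MonoidalClosed.curry_natural_left, ← MonoidalClosed.curry_natural_left, hk])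

theorem whiskerLeft_summandι_tensorEnvDesc {T Y : M} (k : ∀ m, T ⊗ A.envSummand m ⟶ Y)
    (hk : ∀ (m : ℕ) (j : Arities m),
      T ◁ A.relationAct j ≫ k m = T ◁ A.relationComp j ≫ k j.sum) (m : ℕ) :
    T ◁ A.summandι m ≫ A.tensorEnvDesc k hk = k m := by
  rw [tensorEnvDesc, ← MonoidalClosed.uncurry_natural_left, summandι_envDesc,
    MonoidalClosed.uncurry_curry]

theorem env_tensor_hom_ext {T Y : M} {f g : A.env ⊗ T ⟶ Y}
    (h : ∀ m, A.summandι m ▷ T ≫ f = A.summandι m ▷ T ≫ g) : f = g := by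
  rw [← cancel_epi (β_ T A.env).hom]
  refine A.tensor_env_hom_ext fun m => ?_
  rw [BraidedCategory.braiding_naturality_right_assoc,
    BraidedCategory.braiding_naturality_right_assoc, h]

/-- The map out of `env A ⊗ T` induced by compatible maps on the summands of `env A`. -/
def envTensorDesc {T Y : M} (k : ∀ m, A.envSummand m ⊗ T ⟶ Y)
    (hk : ∀ (m : ℕ) (j : Arities m),
      A.relationAct j ▷ T ≫ k m = A.relationComp j ▷ T ≫ k j.sum) :
    A.env ⊗ T ⟶ Y :=
  (β_ T A.env).inv ≫ A.tensorEnvDesc (fun m => (β_ T _).hom ≫ k m) fun _ j => by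
    rw [BraidedCategory.braiding_naturality_right_assoc,
      BraidedCategory.braiding_naturality_right_assoc, hk]

theorem summandι_whiskerRight_envTensorDesc {T Y : M} (k : ∀ m, A.envSummand m ⊗ T ⟶ Y)
    (hk : ∀ (m : ℕ) (j : Arities m),
      A.relationAct j ▷ T ≫ k m = A.relationComp j ▷ T ≫ k j.sum) (m : ℕ) :
    A.summandι m ▷ T ≫ A.envTensorDesc k hk = k m := by
  rw [envTensorDesc, BraidedCategory.braiding_inv_naturality_left_assoc,
    whiskerLeft_summandι_tensorEnvDesc, Iso.inv_hom_id_assoc]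

theorem env_tensor_env_hom_ext {Y : M} {f g : A.env ⊗ A.env ⟶ Y}
    (h : ∀ m n, (A.summandι m ⊗ₘ A.summandι n) ≫ f = (A.summandι m ⊗ₘ A.summandι n) ≫ g) :
    f = g := by
  refine A.env_tensor_hom_ext fun m => A.tensor_env_hom_ext fun n => ?_
  simpa only [MonoidalCategory.tensorHom_def', Category.assoc] using h m n

theorem env_tensor_env_tensor_hom_ext {T Y : M} {f g : (A.env ⊗ A.env) ⊗ T ⟶ Y}
    (h : ∀ m n, (A.summandι m ⊗ₘ A.summandι n) ▷ T ≫ f =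
      (A.summandι m ⊗ₘ A.summandι n) ▷ T ≫ g) : f = g := by
  rw [← cancel_epi (β_ _ _).hom]
  apply MonoidalClosed.curry_injective
  refine A.env_tensor_env_hom_ext fun m n => ?_
  rw [← MonoidalClosed.curry_natural_left, ← MonoidalClosed.curry_natural_left,
    BraidedCategory.braiding_naturality_right_assoc,
    BraidedCategory.braiding_naturality_right_assoc, h]

end Closed

theorem castObj_whiskerRight_summandMul {m m' : ℕ} (h : m = m') (n : ℕ) :
    castObj A.envSummand h ▷ A.envSummand n ≫ A.summandMul m' n ≫ A.summandι (m' + n) =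
      A.summandMul m n ≫ A.summandι (m + n) := by
  subst h; simp

theorem whiskerLeft_castObj_summandMul (m : ℕ) {n n' : ℕ} (h : n = n') :
    A.envSummand m ◁ castObj A.envSummand h ≫ A.summandMul m n' ≫ A.summandι (m + n') =
      A.summandMul m n ≫ A.summandι (m + n) := by
  subst h; simp

theorem relationAct_tensorHom_summandMul (hO : O.LastInputLaws) {m n : ℕ} (j : Arities m)
    (k : Arities n) :
    (A.relationAct j ⊗ₘ A.relationAct k) ≫ A.summandMul m n ≫ A.summandι (m + n) =
      (A.relationComp j ⊗ₘ A.relationComp k) ≫ A.summandMul j.sum k.sum ≫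
        A.summandι (j.sum + k.sum) := by
  rw [← reassoc_of% A.envRelationMul_relationAct, relationAct_summandι,
    reassoc_of% A.envRelationMul_relationComp hO, castObj_summandι]

theorem relationAct_summandMul (hO : O.LastInputLaws) {m : ℕ} (j : Arities m) (n : ℕ) :
    A.relationAct j ▷ A.envSummand n ≫ A.summandMul m n ≫ A.summandι (m + n) =
      A.relationComp j ▷ A.envSummand n ≫ A.summandMul j.sum n ≫ A.summandι (j.sum + n) := by
  have both := congrArg (_ ◁ A.envRelationUnit n ≫ ·)
    (A.relationAct_tensorHom_summandMul hO j (Arities.ones n))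
  beta_reduce at both
  rwa [whiskerLeft_comp_tensorHom_assoc, whiskerLeft_comp_tensorHom_assoc,
    envRelationUnit_relationAct, A.envRelationUnit_relationComp hO, tensorHom_id,
    MonoidalCategory.tensorHom_def, Category.assoc, whiskerLeft_castObj_summandMul] at both

theorem summandMul_relationAct (hO : O.LastInputLaws) (m : ℕ) {n : ℕ} (k : Arities n) :
    A.envSummand m ◁ A.relationAct k ≫ A.summandMul m n ≫ A.summandι (m + n) =
      A.envSummand m ◁ A.relationComp k ≫ A.summandMul m k.sum ≫ A.summandι (m + k.sum) := by
  have both := congrArg (A.envRelationUnit m ▷ _ ≫ ·)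
    (A.relationAct_tensorHom_summandMul hO (Arities.ones m) k)
  beta_reduce at both
  rwa [whiskerRight_comp_tensorHom_assoc, whiskerRight_comp_tensorHom_assoc,
    envRelationUnit_relationAct, A.envRelationUnit_relationComp hO, id_tensorHom,
    MonoidalCategory.tensorHom_def', Category.assoc, castObj_whiskerRight_summandMul] at both

variable [MonoidalClosed M]

/-- The left multiplication of the summand `O(m+1) ⊗ A^(m)` on the enveloping algebra. -/
def summandMulEnv (hO : O.LastInputLaws) (m : ℕ) : A.envSummand m ⊗ A.env ⟶ A.env :=
  A.tensorEnvDesc (fun n => A.summandMul m n ≫ A.summandι (m + n)) fun _ k =>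
    A.summandMul_relationAct hO m k

/-- The multiplication of the enveloping algebra. -/
def envMul (hO : O.LastInputLaws) : A.env ⊗ A.env ⟶ A.env :=
  A.envTensorDesc (A.summandMulEnv hO) fun _ j => A.tensor_env_hom_ext fun n => by
    rw [whisker_exchange_assoc, whisker_exchange_assoc, summandMulEnv, summandMulEnv,
      whiskerLeft_summandι_tensorEnvDesc, whiskerLeft_summandι_tensorEnvDesc,
      A.relationAct_summandMul hO j n]

theorem whiskerLeft_summandι_envMul (hO : O.LastInputLaws) (m n : ℕ) :
    A.envSummand m ◁ A.summandι n ≫ A.summandι m ▷ A.env ≫ A.envMul hO =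
      A.summandMul m n ≫ A.summandι (m + n) := by
  rw [envMul, summandι_whiskerRight_envTensorDesc, summandMulEnv,
    whiskerLeft_summandι_tensorEnvDesc]

theorem summandι_tensorHom_envMul (hO : O.LastInputLaws) (m n : ℕ) :
    (A.summandι m ⊗ₘ A.summandι n) ≫ A.envMul hO = A.summandMul m n ≫ A.summandι (m + n) := by
  rw [MonoidalCategory.tensorHom_def', Category.assoc, whiskerLeft_summandι_envMul]

/-- The action of the enveloping algebra on `A`. -/
def envSmul : A.env ⊗ A.X ⟶ A.X :=
  A.envTensorDesc A.summandSmul fun _ j => A.relationAct_summandSmul j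

theorem summandι_whiskerRight_envSmul (m : ℕ) :
    A.summandι m ▷ A.X ≫ A.envSmul = A.summandSmul m :=
  A.summandι_whiskerRight_envTensorDesc _ _ m

/-- The unit of the enveloping algebra. -/
def envOne : 𝟙_ M ⟶ A.env := A.summandOne ≫ A.summandι 0

theorem envOne_envMul (hO : O.LastInputLaws) :
    A.envOne ▷ A.env ≫ A.envMul hO = (λ_ A.env).hom := by
  refine A.tensor_env_hom_ext fun n => ?_
  rw [envOne, comp_whiskerRight_assoc, whisker_exchange_assoc, whiskerLeft_summandι_envMul,
    reassoc_of% A.summandOne_summandMul hO n, castObj_summandι, leftUnitor_naturality]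

theorem envMul_envOne (hO : O.LastInputLaws) :
    A.env ◁ A.envOne ≫ A.envMul hO = (ρ_ A.env).hom := by
  refine A.env_tensor_hom_ext fun m => ?_
  rw [envOne, MonoidalCategory.whiskerLeft_comp_assoc, ← whisker_exchange_assoc,
    ← MonoidalCategory.tensorHom_def_assoc, summandι_tensorHom_envMul,
    reassoc_of% A.summandMul_summandOne hO m, rightUnitor_naturality]
  rfl

theorem envMul_assoc (hO : O.LastInputLaws) :
    A.envMul hO ▷ A.env ≫ A.envMul hO =
      (α_ _ _ _).hom ≫ A.env ◁ A.envMul hO ≫ A.envMul hO := by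
  refine A.env_tensor_env_tensor_hom_ext fun m n => A.tensor_env_hom_ext fun p => ?_
  rw [← comp_whiskerRight_assoc, summandι_tensorHom_envMul, comp_whiskerRight_assoc,
    whisker_exchange_assoc, whiskerLeft_summandι_envMul,
    reassoc_of% A.summandMul_assoc hO m n p, castObj_summandι,
    ← MonoidalCategory.tensorHom_def'_assoc, associator_naturality_assoc,
    tensorHom_comp_whiskerLeft_assoc, summandι_tensorHom_envMul,
    ← whiskerLeft_comp_tensorHom_assoc, summandι_tensorHom_envMul]

theorem envOne_envSmul : A.envOne ▷ A.X ≫ A.envSmul = (λ_ A.X).hom := by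
  rw [envOne, comp_whiskerRight_assoc, summandι_whiskerRight_envSmul, summandOne_summandSmul]

theorem envMul_envSmul (hO : O.LastInputLaws) :
    A.envMul hO ▷ A.X ≫ A.envSmul = (α_ _ _ _).hom ≫ A.env ◁ A.envSmul ≫ A.envSmul := by
  refine A.env_tensor_env_tensor_hom_ext fun m n => ?_
  rw [← comp_whiskerRight_assoc, summandι_tensorHom_envMul, comp_whiskerRight_assoc,
    summandι_whiskerRight_envSmul, summandMul_summandSmul, MonoidalCategory.tensorHom_def,
    comp_whiskerRight_assoc, associator_naturality_middle_assoc,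
    associator_naturality_left_assoc, ← MonoidalCategory.whiskerLeft_comp_assoc,
    summandι_whiskerRight_envSmul, ← whisker_exchange_assoc, summandι_whiskerRight_envSmul]

/-- The monoid structure of the enveloping algebra. -/
@[reducible]
def envMonObj (hO : O.LastInputLaws) : MonObj A.env where
  one := A.envOne
  mul := A.envMul hO
  one_mul := A.envOne_envMul hO
  mul_one := A.envMul_envOne hO
  mul_assoc := A.envMul_assoc hO

/-- The enveloping algebra structure of an operad whose compositions in the last input are
associative and unital. -/
def envStructure (hO : O.LastInputLaws) : A.EnvStructure :=
  let _ := A.envMonObj hO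
  { mon := A.envMonObj hO
    one_eq := Category.assoc _ _ _
    ι_mul := A.summandι_tensorHom_envMul hO
    mod :=
      { smul := A.envSmul
        one_smul := A.envOne_envSmul
        mul_smul := A.envMul_envSmul hO }
    ι_smul := A.summandι_whiskerRight_envSmul }

end OperadAlgebra

/-! ## Transport along a braided functor -/

open Functor.LaxMonoidal

section Map

theorem map_castObj {C : Type u} [Category.{v} C] {D : Type*} [Category* D] (F : C ⥤ D)
    (X : ℕ → C) {m n : ℕ} (h : m = n) :
    F.map (castObj X h) = castObj (fun n => F.obj (X n)) h := by
  subst h; simp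

theorem comp_map_castObj {C : Type u} [Category.{v} C] {D : Type*} [Category* D] (F : C ⥤ D)
    (X : ℕ → C) {m n : ℕ} (h : m = n) {Y : C} {Z : D} (f : Z ⟶ F.obj Y) (g : Y ⟶ X m) :
    (f ≫ F.map g) ≫ castObj (fun n => F.obj (X n)) h = f ≫ F.map (g ≫ castObj X h) := by
  rw [F.map_comp, map_castObj, Category.assoc]

theorem tensorHom_whiskerRight {D : Type*} [Category* D] [MonoidalCategory D] {X Y X' Y' : D}
    (f : X ⟶ X') (g : Y ⟶ Y') (Z : D) :
    (f ⊗ₘ g) ▷ Z = (α_ _ _ _).hom ≫ (f ⊗ₘ g ▷ Z) ≫ (α_ _ _ _).inv := by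
  rw [← tensorHom_id, ← tensorHom_id, associator_conjugation]

variable {C : Type u} [Category.{v} C] [MonoidalCategory C] {D : Type*} [Category* D]
  [MonoidalCategory D] (F : C ⥤ D) [F.Monoidal]

theorem tensorFamAppend_tensorFamComparison (X : ℕ → C) {m : ℕ} (j : Arities m) :
    {n : ℕ} → (k : Arities n) →
      tensorFamAppend (fun n => F.obj (X n)) j k ≫ tensorFamComparison F X (j.append k) =
        (tensorFamComparison F X j ⊗ₘ tensorFamComparison F X k) ≫ μ F _ _ ≫
          F.map (tensorFamAppend X j k)
  | _, .nil => by
    dsimp only [tensorFamAppend, tensorFamComparison, tensorFam, Arities.append]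
    rw [MonoidalCategory.tensorHom_def, Category.assoc, ← right_unitality,
      rightUnitor_naturality]
  | _, .snoc k a => by
    have ih := tensorFamAppend_tensorFamComparison X j k
    dsimp only [tensorFamAppend, tensorFamComparison, tensorFam, Arities.append]
    rw [Category.assoc, ← comp_whiskerRight_assoc, ih, F.map_comp,
      ← tensorHom_comp_whiskerLeft_assoc, associativity_inv_assoc]
    simp only [comp_whiskerRight, Category.assoc, μ_natural_left, tensorHom_whiskerRight,
      Iso.inv_hom_id_assoc]

theorem whiskerLeft_rightUnitor_inv_μ {X T U V : C} {T' : D} (f : 𝟙_ C ⟶ U) (t : T' ⟶ F.obj T)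
    (c : X ⊗ (T ⊗ U) ⟶ V) :
    F.obj X ◁ ((ρ_ T').inv ≫ T' ◁ (ε F ≫ F.map f)) ≫
        F.obj X ◁ (t ▷ F.obj U ≫ μ F T U) ≫ μ F X (T ⊗ U) ≫ F.map c =
      F.obj X ◁ t ≫ μ F X T ≫ F.map (X ◁ ((ρ_ T).inv ≫ T ◁ f) ≫ c) := by
  rw [F.map_comp, ← μ_natural_right_assoc, F.map_comp, ← right_unitality_inv]
  simp only [← MonoidalCategory.whiskerLeft_comp_assoc, Category.assoc]
  rw [whisker_exchange_assoc, MonoidalCategory.whiskerLeft_comp (F.obj T), Category.assoc,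
    ← μ_natural_right, rightUnitor_inv_naturality_assoc]

theorem whiskerLeft_leftUnitor_inv_μ {X T Q V : C} {T' : D} (o' : 𝟙_ D ⟶ T') (o : 𝟙_ C ⟶ T)
    (t : T' ⟶ F.obj T) (h : o' ≫ t = ε F ≫ F.map o) (c : X ⊗ (T ⊗ Q) ⟶ V) :
    F.obj X ◁ ((λ_ (F.obj Q)).inv ≫ o' ▷ F.obj Q) ≫
        F.obj X ◁ (t ▷ F.obj Q ≫ μ F T Q) ≫ μ F X (T ⊗ Q) ≫ F.map c =
      μ F X Q ≫ F.map (X ◁ ((λ_ Q).inv ≫ o ▷ Q) ≫ c) := by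
  rw [F.map_comp, ← μ_natural_right_assoc, F.map_comp, ← left_unitality_inv]
  simp only [← MonoidalCategory.whiskerLeft_comp_assoc, Category.assoc]
  rw [← comp_whiskerRight_assoc, h, comp_whiskerRight_assoc, ← μ_natural_left]

namespace OperadData

variable (O : OperadData C)

theorem map_compOne {m : ℕ} (j : Arities m) : (O.map F).compOne j =
    F.obj (O.obj (m + 1)) ◁ tensorFamComparison F O.obj j ≫ μ F _ _ ≫ F.map (O.compOne j) :=
  whiskerLeft_rightUnitor_inv_μ F O.one (tensorFamComparison F O.obj j) (O.compSnoc j 1)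

theorem map_oneFam : (m : ℕ) → (O.map F).oneFam m ≫ tensorFamComparison F O.obj (Arities.ones m) =
    ε F ≫ F.map (O.oneFam m)
  | 0 => by
    dsimp only [oneFam, map, tensorFamComparison, tensorFam, Arities.ones]
    rw [F.map_id, Category.id_comp, Category.comp_id]
  | m + 1 => by
    have ih := map_oneFam m
    dsimp only [oneFam, map, tensorFamComparison, tensorFam, Arities.ones] at ih ⊢
    rw [Category.assoc, tensorHom_comp_whiskerRight_assoc, ih, F.map_comp, ← left_unitality_inv,
      ← tensorHom_comp_tensorHom_assoc, MonoidalCategory.tensorHom_def', Category.assoc,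
      μ_natural]
    simp

theorem map_compLastOp (m q : ℕ) :
    (O.map F).compLastOp m q = μ F _ _ ≫ F.map (O.compLastOp m q) := by
  have unit_insertion := whiskerLeft_leftUnitor_inv_μ F _ _ _ (O.map_oneFam F m)
    (O.compSnoc (Arities.ones m) q)
  rw [compLastOp, compLastOp, ← Category.assoc (_ ◁ _) (O.compSnoc _ _)]
  exact (Category.assoc _ _ _).symm.trans
    ((congrArg (· ≫ castObj _ _) unit_insertion).trans (comp_map_castObj F _ _ _ _))

theorem map_compLast (m n : ℕ) : (O.map F).compLast m n = μ F _ _ ≫ F.map (O.compLast m n) :=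
  O.map_compLastOp F m (n + 1)

end OperadData

end Map

section BraidedMap

variable {C : Type u} [Category.{v} C] [MonoidalCategory C] [BraidedCategory C] {D : Type*}
  [Category* D] [MonoidalCategory D] [BraidedCategory D]

theorem tensorμ_tensorHom_μ (F : C ⥤ D) [F.Braided] {X Y T U W Z : C} {S S' : D}
    (s : S ⟶ F.obj T) (t : S' ⟶ F.obj U) (f : X ⊗ Y ⟶ W) (g : T ⊗ U ⟶ Z) :
    tensorμ (F.obj X) S (F.obj Y) S' ≫
        ((μ F X Y ≫ F.map f) ⊗ₘ ((s ⊗ₘ t) ≫ μ F T U ≫ F.map g)) ≫ μ F W Z =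
      (F.obj X ◁ s ⊗ₘ F.obj Y ◁ t) ≫ (μ F X T ⊗ₘ μ F Y U) ≫ μ F _ _ ≫
        F.map (tensorμ X T Y U) ≫ F.map (f ⊗ₘ g) := by
  have naturality := tensorμ_natural (𝟙 (F.obj X)) s (𝟙 (F.obj Y)) t
  simp only [id_tensorHom, MonoidalCategory.whiskerLeft_id] at naturality
  rw [← whiskerLeft_comp_tensorHom, ← tensorHom_comp_tensorHom, Category.assoc, Category.assoc,
    ← reassoc_of% naturality, μ_natural, reassoc_of% tensorμ_comp_μ_tensorHom_μ_comp_μ F]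

theorem OperadData.LastInputLaws.map {O : OperadData C} (hO : O.LastInputLaws) (F : C ⥤ D)
    [F.Braided] : (O.map F).LastInputLaws where
  one_compLast n := by
    have law := congrArg (fun f => F.map f) (hO.one_compLast n)
    rw [O.map_compLast F]
    dsimp only [OperadData.map] at law ⊢
    rw [F.map_comp, F.map_comp, map_castObj] at law
    rw [comp_whiskerRight_assoc, μ_natural_left_assoc, law, left_unitality_assoc]
  compLast_one m := by
    have law := congrArg (fun f => F.map f) (hO.compLast_one m)
    rw [O.map_compLast F]
    dsimp only [OperadData.map] at law ⊢
    rw [F.map_comp] at law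
    rw [MonoidalCategory.whiskerLeft_comp_assoc, μ_natural_right_assoc, law, right_unitality]
  compLast_assoc m n p := by
    have law := congrArg (fun f => F.map f) (hO.compLast_assoc m n p)
    rw [O.map_compLast F, O.map_compLast F, O.map_compLast F, O.map_compLast F]
    dsimp only [OperadData.map] at law ⊢
    simp only [F.map_comp, map_castObj] at law
    rw [comp_whiskerRight_assoc, μ_natural_left_assoc, law, associativity_assoc]
    simp
  compOne_append j k := by
    have law := congrArg (fun f => F.map f) (hO.compOne_append j k)
    rw [O.map_compLast F, O.map_compLast F, O.map_compOne F, O.map_compOne F, O.map_compOne F]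
    dsimp only [OperadData.map] at law ⊢
    simp only [F.map_comp, map_castObj] at law
    rw [tensorHom_comp_whiskerLeft_assoc, tensorFamAppend_tensorFamComparison,
      reassoc_of% tensorμ_tensorHom_μ F, law]
    simp only [← MonoidalCategory.tensorHom_comp_tensorHom_assoc, Category.assoc, μ_natural_assoc]
  compOne_ones m := by
    have law := congrArg (fun f => F.map f) (hO.compOne_ones m)
    have map_oneFam := O.map_oneFam F m
    rw [O.map_compOne F]
    dsimp only [OperadData.map] at law map_oneFam ⊢
    simp only [F.map_comp, map_castObj] at law
    rw [← MonoidalCategory.whiskerLeft_comp_assoc, map_oneFam,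
      MonoidalCategory.whiskerLeft_comp_assoc, μ_natural_right_assoc, law, right_unitality_assoc]

end BraidedMap

/-! ## Composition laws of little intervals -/

section Points

variable {P : ObjectProperty TopCat.{w}}

/-- The value of a map of spaces at a point. -/
def value {X Y : P.FullSubcategory} (f : X ⟶ Y) (x : X.obj) : Y.obj := f.hom x

theorem value_ext {X Y : P.FullSubcategory} {f g : X ⟶ Y} (h : ∀ x, value f x = value g x) :
    f = g :=
  ObjectProperty.hom_ext _ (TopCat.ext h)

@[simp] theorem value_id {X : P.FullSubcategory} (x : X.obj) : value (𝟙 X) x = x := rfl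

@[simp] theorem value_comp {X Y Z : P.FullSubcategory} (f : X ⟶ Y) (g : Y ⟶ Z) (x : X.obj) :
    value (f ≫ g) x = value g (value f x) := rfl

@[simp] theorem value_constMap {X Y : P.FullSubcategory} (y : Y.obj) (x : X.obj) :
    value (constMap y : X ⟶ Y) x = y := rfl

variable [CartesianMonoidalCategory P.FullSubcategory]

/-- The first coordinate of a point of a product. -/
def left {X Y : P.FullSubcategory} (p : (X ⊗ Y).obj) : X.obj := value (fst X Y) p

/-- The second coordinate of a point of a product. -/
def right {X Y : P.FullSubcategory} (p : (X ⊗ Y).obj) : Y.obj := value (snd X Y) p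

section Product

variable {X Y Z W X' Y' : P.FullSubcategory}

theorem left_value (f : Z ⟶ X ⊗ Y) (z : Z.obj) : left (value f z) = value (f ≫ fst X Y) z := rfl

theorem right_value (f : Z ⟶ X ⊗ Y) (z : Z.obj) : right (value f z) = value (f ≫ snd X Y) z := rfl

@[simp] theorem value_fst (p : (X ⊗ Y).obj) : value (fst X Y) p = left p := rfl

@[simp] theorem value_snd (p : (X ⊗ Y).obj) : value (snd X Y) p = right p := rfl

@[simp] theorem left_tensorHom (f : X ⟶ X') (g : Y ⟶ Y') (p : (X ⊗ Y).obj) :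
    left (value (f ⊗ₘ g) p) = value f (left p) := by simp [left_value]

@[simp] theorem right_tensorHom (f : X ⟶ X') (g : Y ⟶ Y') (p : (X ⊗ Y).obj) :
    right (value (f ⊗ₘ g) p) = value g (right p) := by simp [right_value]

@[simp] theorem left_whiskerLeft (g : Y ⟶ Y') (p : (X ⊗ Y).obj) :
    left (value (X ◁ g) p) = left p := by simp [left_value]

@[simp] theorem right_whiskerLeft (g : Y ⟶ Y') (p : (X ⊗ Y).obj) :
    right (value (X ◁ g) p) = value g (right p) := by simp [right_value]

@[simp] theorem left_whiskerRight (f : X ⟶ X') (p : (X ⊗ Y).obj) :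
    left (value (f ▷ Y) p) = value f (left p) := by simp [left_value]

@[simp] theorem right_whiskerRight (f : X ⟶ X') (p : (X ⊗ Y).obj) :
    right (value (f ▷ Y) p) = right p := by simp [right_value]

@[simp] theorem left_associator_hom (p : ((X ⊗ Y) ⊗ Z).obj) :
    left (value (α_ X Y Z).hom p) = left (left p) := by simp [left_value]

@[simp] theorem left_right_associator_hom (p : ((X ⊗ Y) ⊗ Z).obj) :
    left (right (value (α_ X Y Z).hom p)) = right (left p) := by
  rw [right_value, left_value]; simp

@[simp] theorem right_right_associator_hom (p : ((X ⊗ Y) ⊗ Z).obj) :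
    right (right (value (α_ X Y Z).hom p)) = right p := by
  rw [right_value, right_value]; simp

@[simp] theorem left_left_associator_inv (p : (X ⊗ (Y ⊗ Z)).obj) :
    left (left (value (α_ X Y Z).inv p)) = left p := by
  rw [left_value, left_value]; simp

@[simp] theorem right_left_associator_inv (p : (X ⊗ (Y ⊗ Z)).obj) :
    right (left (value (α_ X Y Z).inv p)) = left (right p) := by
  rw [left_value, right_value]; simp

@[simp] theorem right_associator_inv (p : (X ⊗ (Y ⊗ Z)).obj) :
    right (value (α_ X Y Z).inv p) = right (right p) := by
  rw [right_value]; simp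

@[simp] theorem value_rightUnitor_hom (p : (X ⊗ 𝟙_ P.FullSubcategory).obj) :
    value (ρ_ X).hom p = left p := by
  rw [rightUnitor_hom, value_fst]

@[simp] theorem value_leftUnitor_hom (p : (𝟙_ P.FullSubcategory ⊗ X).obj) :
    value (λ_ X).hom p = right p := by
  rw [leftUnitor_hom, value_snd]

@[simp] theorem left_rightUnitor_inv (x : X.obj) : left (value (ρ_ X).inv x) = x := by
  simp [left_value]

@[simp] theorem right_leftUnitor_inv (x : X.obj) : right (value (λ_ X).inv x) = x := by
  simp [right_value]

theorem left_right_whiskerLeft_rightUnitor_inv (o : 𝟙_ P.FullSubcategory ⟶ Z) (p : (X ⊗ Y).obj) :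
    left (right (value (X ◁ ((ρ_ Y).inv ≫ Y ◁ o)) p)) = right p := by simp

theorem right_right_whiskerLeft_rightUnitor_inv (o : 𝟙_ P.FullSubcategory ⟶ Z) (p : (X ⊗ Y).obj) :
    right (right (value (X ◁ ((ρ_ Y).inv ≫ Y ◁ o)) p)) =
      value o (right (value (ρ_ Y).inv (right p))) := by
  rw [right_whiskerLeft, value_comp, right_whiskerLeft]

theorem left_right_whiskerLeft_leftUnitor_inv (o : 𝟙_ P.FullSubcategory ⟶ Z) (p : (X ⊗ Y).obj) :
    left (right (value (X ◁ ((λ_ Y).inv ≫ o ▷ Y)) p)) =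
      value o (left (value (λ_ Y).inv (right p))) := by
  rw [right_whiskerLeft, value_comp, left_whiskerRight]

theorem right_right_whiskerLeft_leftUnitor_inv (o : 𝟙_ P.FullSubcategory ⟶ Z) (p : (X ⊗ Y).obj) :
    right (right (value (X ◁ ((λ_ Y).inv ≫ o ▷ Y)) p)) = right p := by simp

theorem left_leftUnitor_inv_tensorHom (f : 𝟙_ P.FullSubcategory ⟶ X)
    (g : 𝟙_ P.FullSubcategory ⟶ Y) (p : (𝟙_ P.FullSubcategory).obj) :
    left (value ((λ_ (𝟙_ P.FullSubcategory)).inv ≫ (f ⊗ₘ g)) p) =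
      value f (left (value (λ_ (𝟙_ P.FullSubcategory)).inv p)) := by
  rw [value_comp, left_tensorHom]

theorem right_leftUnitor_inv_tensorHom (f : 𝟙_ P.FullSubcategory ⟶ X)
    (g : 𝟙_ P.FullSubcategory ⟶ Y) (p : (𝟙_ P.FullSubcategory).obj) :
    right (value ((λ_ (𝟙_ P.FullSubcategory)).inv ≫ (f ⊗ₘ g)) p) = value g p := by
  rw [value_comp, right_tensorHom, right_leftUnitor_inv]

theorem left_associator_inv_whiskerRight (f : X ⊗ Y ⟶ W) (p : (X ⊗ (Y ⊗ Z)).obj) :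
    left (value ((α_ X Y Z).inv ≫ f ▷ Z) p) = value f (left (value (α_ X Y Z).inv p)) := by
  rw [value_comp, left_whiskerRight]

theorem right_associator_inv_whiskerRight (f : X ⊗ Y ⟶ W) (p : (X ⊗ (Y ⊗ Z)).obj) :
    right (value ((α_ X Y Z).inv ≫ f ▷ Z) p) = right (right p) := by simp

@[simp] theorem left_tensorμ [BraidedCategory P.FullSubcategory] (p : ((X ⊗ Y) ⊗ (Z ⊗ W)).obj) :
    left (value (tensorμ X Y Z W) p) = value (fst X Y ⊗ₘ fst Z W) p := by
  rw [left_value, tensorμ_fst]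

@[simp] theorem right_tensorμ [BraidedCategory P.FullSubcategory] (p : ((X ⊗ Y) ⊗ (Z ⊗ W)).obj) :
    right (value (tensorμ X Y Z W) p) = value (snd X Y ⊗ₘ snd Z W) p := by
  rw [right_value, tensorμ_snd]

end Product

end Points

/-- The list obtained by composing the intervals in the `i`-th entry of `d` with the `i`-th
interval of `c`. -/
def composeList (c : List (ℝ × ℝ)) (d : List (List (ℝ × ℝ))) : List (ℝ × ℝ) :=
  (List.zipWith (fun p => List.map (rescale p)) c d).flatten

theorem rescale_zero_one (p : ℝ × ℝ) : rescale p (0, 1) = p := by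
  simp [rescale]

theorem zero_one_rescale (p : ℝ × ℝ) : rescale (0, 1) p = p := by
  simp [rescale]

theorem rescale_rescale (p q r : ℝ × ℝ) :
    rescale (rescale p q) r = rescale p (rescale q r) := by
  simp only [rescale, Prod.mk.injEq]
  constructor <;> ring

theorem rescale_comp_rescale (p q : ℝ × ℝ) :
    rescale p ∘ rescale q = rescale (rescale p q) :=
  funext fun r => (rescale_rescale p q r).symm

theorem composeList_append {c c' : List (ℝ × ℝ)} {d d' : List (List (ℝ × ℝ))}
    (h : c.length = d.length) :
    composeList (c ++ c') (d ++ d') = composeList c d ++ composeList c' d' := by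
  rw [composeList, List.zipWith_append h, List.flatten_append]
  rfl

theorem composeList_singleton (p : ℝ × ℝ) (y : List (ℝ × ℝ)) :
    composeList [p] [y] = y.map (rescale p) := by
  simp [composeList]

theorem composeList_map_rescale (p : ℝ × ℝ) (c : List (ℝ × ℝ)) (d : List (List (ℝ × ℝ))) :
    composeList (c.map (rescale p)) d = (composeList c d).map (rescale p) := by
  induction c generalizing d with
  | nil => simp [composeList]
  | cons q c ih =>
    cases d with
    | nil => simp [composeList]
    | cons y d =>
      have tail := ih d
      simp only [composeList] at tail
      simp [composeList, tail, rescale_comp_rescale]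

theorem composeList_replicate (c : List (ℝ × ℝ)) :
    composeList c (List.replicate c.length [(0, 1)]) = c := by
  induction c with
  | nil => rfl
  | cons p c ih =>
    simp only [composeList] at ih
    simp [composeList, List.replicate_succ, ih, rescale_zero_one]

section Lists

variable {P : ObjectProperty TopCat.{w}} [ContainsConvexSets P]

/-- The list of intervals given by a point of the space of little intervals. -/
def toList {m : ℕ} (c : (intervals P m).obj) : List (ℝ × ℝ) := List.ofFn (endpoints c)

@[simp] theorem length_toList {m : ℕ} (c : (intervals P m).obj) : (toList c).length = m :=
  List.length_ofFn

theorem endpoints_injective {m : ℕ} {c d : (intervals P m).obj} (h : endpoints c = endpoints d) :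
    c = d :=
  ULift.down_injective (Subtype.ext h)

theorem toList_injective {m : ℕ} {c d : (intervals P m).obj} (h : toList c = toList d) : c = d :=
  endpoints_injective (List.ofFn_injective h)

theorem intervals_hom_ext {X : P.FullSubcategory} {m : ℕ} {f g : X ⟶ intervals P m}
    (h : ∀ x, toList (value f x) = toList (value g x)) : f = g :=
  value_ext fun x => toList_injective (h x)

@[simp] theorem toList_castObj {m n : ℕ} (h : m = n) (c : (intervals P m).obj) :
    toList (value (castObj (intervals P) h) c) = toList c := by
  subst h; rfl

theorem exists_toList_eq_concat {m : ℕ} (c : (intervals P (m + 1)).obj) :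
    ∃ (c' : List (ℝ × ℝ)) (p : ℝ × ℝ), c'.length = m ∧ toList c = c' ++ [p] :=
  ⟨List.ofFn fun i : Fin m => endpoints c i.castSucc, endpoints c (Fin.last m), by simp, by
    rw [toList, List.ofFn_succ_last]⟩

variable [CartesianMonoidalCategory P.FullSubcategory]

/-- The list of lists of intervals given by a tuple of points of spaces of little intervals. -/
def famToList : {m : ℕ} → (j : Arities m) → (tensorFam (intervals P) j).obj →
    List (List (ℝ × ℝ))
  | _, .nil, _ => []
  | _, .snoc j a, d => famToList j (left (Y := intervals P a) d) ++
      [toList (right (X := tensorFam (intervals P) j) (Y := intervals P a) d)]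

@[simp] theorem length_famToList : {m : ℕ} → (j : Arities m) →
    (d : (tensorFam (intervals P) j).obj) → (famToList j d).length = m
  | _, .nil, _ => rfl
  | _, .snoc j a, d => by simp [famToList, length_famToList j]

theorem ofFn_composeFun : {m : ℕ} → (j : Arities m) → (c : Fin m → ℝ × ℝ) →
    (d : (tensorFam (intervals P) j).obj) →
    List.ofFn (composeFun P j c d) = composeList (List.ofFn c) (famToList j d)
  | _, .nil, _, _ => by
    simp only [Arities.sum, List.ofFn_zero]
    rfl
  | m + 1, .snoc j a, c, d => by
    rw [List.ofFn_succ_last, famToList, composeList_append (by simp), composeList_singleton,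
      ← ofFn_composeFun j]
    refine (List.ofFn_fin_append _ _).trans (congrArg₂ _ rfl ?_)
    simp only [toList, List.map_ofFn]
    rfl

theorem toList_comp {m : ℕ} (j : Arities m) (p : (intervals P m ⊗ tensorFam (intervals P) j).obj) :
    toList (value ((littleIntervals P).comp j) p) =
      composeList (toList (left p)) (famToList j (right p)) :=
  ofFn_composeFun j _ _

variable (P) in
/-- The unit of the operad of little intervals. -/
def unitPoint : 𝟙_ P.FullSubcategory ⟶ intervals P 1 := (littleIntervals P).one

variable (P) in
/-- The tuple of units of the operad of little intervals. -/
def unitPoints (m : ℕ) : 𝟙_ P.FullSubcategory ⟶ tensorFam (intervals P) (Arities.ones m) :=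
  (littleIntervals P).oneFam m

/-- The composition of little intervals with the unit in the last input. -/
def composeOne {m : ℕ} (j : Arities m) :
    intervals P (m + 1) ⊗ tensorFam (intervals P) j ⟶ intervals P (j.sum + 1) :=
  (littleIntervals P).compOne j

variable (P) in
/-- The composition of little intervals in the last input. -/
def composeLast (m q : ℕ) : intervals P (m + 1) ⊗ intervals P q ⟶ intervals P (m + q) :=
  (littleIntervals P).compLastOp m q

theorem toList_unitPoint (p : (𝟙_ P.FullSubcategory).obj) :
    toList (value (unitPoint P) p) = [(0, 1)] :=
  List.ofFn_succ.trans rfl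

theorem toList_composeOne {m : ℕ} (j : Arities m)
    (p : (intervals P (m + 1) ⊗ tensorFam (intervals P) j).obj) :
    toList (value (composeOne j) p) =
      composeList (toList (left p)) (famToList j (right p) ++ [[(0, 1)]]) := by
  refine (toList_comp (Arities.snoc j 1) _).trans (congrArg₂ composeList
    (congrArg toList (left_whiskerLeft _ _)) (congrArg₂ (· ++ [·])
      (congrArg (famToList j) (left_right_whiskerLeft_rightUnitor_inv (unitPoint P) p)) ?_))
  exact (congrArg toList (right_right_whiskerLeft_rightUnitor_inv (unitPoint P) p)).trans
    (toList_unitPoint _)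

theorem famToList_unitPoints : (m : ℕ) → (p : (𝟙_ P.FullSubcategory).obj) →
    famToList (Arities.ones m) (value (unitPoints P m) p) =
      List.replicate m [(0, 1)]
  | 0, _ => rfl
  | m + 1, p => by
    rw [List.replicate_succ']
    exact congrArg₂ (· ++ [·])
      ((congrArg (famToList (Arities.ones m))
        (left_leftUnitor_inv_tensorHom (unitPoints P m) (unitPoint P) p)).trans
        (famToList_unitPoints m _))
      ((congrArg toList (right_leftUnitor_inv_tensorHom (unitPoints P m) (unitPoint P) p)).trans
        (toList_unitPoint p))

theorem toList_composeLast (m q : ℕ) (p : (intervals P (m + 1) ⊗ intervals P q).obj) :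
    toList (value (composeLast P m q) p) =
      composeList (toList (left p)) (List.replicate m [(0, 1)] ++ [toList (right p)]) := by
  refine (toList_castObj (congrArg (· + q) (Arities.sum_ones m)) _).trans
    ((toList_comp (Arities.snoc (Arities.ones m) q) _).trans (congrArg₂ composeList
      (congrArg toList (left_whiskerLeft _ _)) (congrArg₂ (· ++ [·]) ?_
        (congrArg toList (right_right_whiskerLeft_leftUnitor_inv (unitPoints P m) p)))))
  exact (congrArg (famToList (Arities.ones m))
    (left_right_whiskerLeft_leftUnitor_inv (unitPoints P m) p)).trans (famToList_unitPoints m _)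

theorem toList_composeLast_of_eq {m q : ℕ} {p : (intervals P (m + 1) ⊗ intervals P q).obj}
    {c : List (ℝ × ℝ)} {r : ℝ × ℝ} (hc : c.length = m) (h : toList (left p) = c ++ [r]) :
    toList (value (composeLast P m q) p) =
      c ++ (toList (right p)).map (rescale r) := by
  subst hc
  rw [toList_composeLast, h, composeList_append (by simp), composeList_replicate,
    composeList_singleton]

theorem toList_composeOne_of_eq {m : ℕ} {j : Arities m}
    {p : (intervals P (m + 1) ⊗ tensorFam (intervals P) j).obj}
    {c : List (ℝ × ℝ)} {r : ℝ × ℝ} (hc : c.length = m) (h : toList (left p) = c ++ [r]) :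
    toList (value (composeOne j) p) =
      composeList c (famToList j (right p)) ++ [r] := by
  rw [toList_composeOne, h, composeList_append (by simp [hc]), composeList_singleton,
    List.map_singleton, rescale_zero_one]

theorem famToList_append {m : ℕ} (j : Arities m) : {n : ℕ} → (k : Arities n) →
    (p : (tensorFam (intervals P) j ⊗ tensorFam (intervals P) k).obj) →
    famToList (j.append k) (value (tensorFamAppend (intervals P) j k) p) =
      famToList j (left p) ++ famToList k (right p)
  | _, .nil, p =>
    (congrArg (famToList j) (value_rightUnitor_hom p)).trans (List.append_nil _).symm
  | _, .snoc k a, p => by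
    refine (congrArg₂ (fun x y => x ++ [toList y])
      ((congrArg (famToList (j.append k))
        (left_associator_inv_whiskerRight (tensorFamAppend (intervals P) j k) p)).trans
        (famToList_append j k _))
      (right_associator_inv_whiskerRight (tensorFamAppend (intervals P) j k) p)).trans ?_
    exact (congrArg₂ (fun x y => famToList j x ++ famToList k y ++ [toList (right (right p))])
      (left_left_associator_inv p) (right_left_associator_inv p)).trans (List.append_assoc _ _ _)

theorem toList_one_composeLast (n : ℕ) (x : (𝟙_ P.FullSubcategory ⊗ intervals P (n + 1)).obj) :
    toList (value (composeLast P 0 (n + 1))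
      (value (unitPoint P ▷ intervals P (n + 1)) x)) = toList (right x) := by
  rw [toList_composeLast_of_eq (m := 0) (c := []) (r := (0, 1)) rfl,
    right_whiskerRight, funext zero_one_rescale, List.map_id', List.nil_append]
  rw [left_whiskerRight]
  exact toList_unitPoint _

theorem toList_composeLast_one (m : ℕ) (x : (intervals P (m + 1) ⊗ 𝟙_ P.FullSubcategory).obj) :
    toList (value (composeLast P m 1)
      (value (intervals P (m + 1) ◁ unitPoint P) x)) = toList (left x) := by
  obtain ⟨c, r, hc, h⟩ := exists_toList_eq_concat (left x)
  rw [toList_composeLast_of_eq (c := c) (r := r) hc, right_whiskerLeft, toList_unitPoint, h,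
    List.map_singleton, rescale_zero_one]
  rw [left_whiskerLeft, h]

theorem toList_composeLast_assoc (m n p : ℕ)
    (x : ((intervals P (m + 1) ⊗ intervals P (n + 1)) ⊗ intervals P (p + 1)).obj) :
    toList (value (composeLast P (m + n) (p + 1))
      (value (composeLast P m (n + 1) ▷ intervals P (p + 1)) x)) =
    toList (value (composeLast P m (n + p + 1))
      (value (intervals P (m + 1) ◁ composeLast P n (p + 1))
        (value (α_ _ _ _).hom x))) := by
  obtain ⟨c, r, hc, left_eq⟩ := exists_toList_eq_concat (left (left x))
  obtain ⟨d, s, hd, middle_eq⟩ := exists_toList_eq_concat (right (left x))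
  have left_composite : toList (left (value (composeLast P m (n + 1) ▷ intervals P (p + 1)) x)) =
      (c ++ d.map (rescale r)) ++ [rescale r s] := by
    rw [left_whiskerRight]
    refine (toList_composeLast_of_eq hc left_eq).trans ?_
    simp [middle_eq]
  have right_composite : toList (value (composeLast P n (p + 1)) (right (value (α_ _ _ _).hom x))) =
      d ++ (toList (right x)).map (rescale s) := by
    rw [toList_composeLast_of_eq hd (by simpa using middle_eq), right_right_associator_hom]
  rw [toList_composeLast_of_eq (m := m + n) (by simp [hc, hd]) left_composite,
    toList_composeLast_of_eq hc (by simpa using left_eq), right_whiskerLeft, right_composite]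
  simp [rescale_comp_rescale]

theorem toList_composeOne_append [BraidedCategory P.FullSubcategory] {m n : ℕ} (j : Arities m)
    (k : Arities n) (x : ((intervals P (m + 1) ⊗ tensorFam (intervals P) j) ⊗
      (intervals P (n + 1) ⊗ tensorFam (intervals P) k)).obj) :
    toList (value (composeOne (j.append k))
      (value (composeLast P m (n + 1) ⊗ₘ tensorFamAppend (intervals P) j k)
        (value (tensorμ _ _ _ _) x))) =
    toList (value (composeLast P j.sum (k.sum + 1))
      (value (composeOne j ⊗ₘ composeOne k) x)) := by
  obtain ⟨c, r, hc, left_eq⟩ := exists_toList_eq_concat (left (left x))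
  obtain ⟨d, s, hd, right_eq⟩ := exists_toList_eq_concat (left (right x))
  have left_composite : toList (left (value
      (composeLast P m (n + 1) ⊗ₘ tensorFamAppend (intervals P) j k) (value (tensorμ _ _ _ _) x))) =
      (c ++ d.map (rescale r)) ++ [rescale r s] := by
    rw [left_tensorHom]
    refine (toList_composeLast_of_eq hc (by simpa using left_eq)).trans ?_
    simp [right_eq]
  have composed_left := toList_composeOne_of_eq (p := left x) hc left_eq
  have composed_length : (composeList c (famToList j (right (left x)))).length = j.sum := by
    simpa using (congrArg List.length composed_left).symm
  rw [toList_composeOne_of_eq (by simp [hc, hd]) left_composite,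
    toList_composeLast_of_eq composed_length ((congrArg toList (left_tensorHom _ _ _)).trans
      composed_left), right_tensorHom, right_tensorHom, famToList_append,
    composeList_append (by simp [hc]), toList_composeOne_of_eq hd right_eq]
  simp [composeList_map_rescale]

theorem toList_composeOne_ones (m : ℕ) (x : (intervals P (m + 1) ⊗ 𝟙_ P.FullSubcategory).obj) :
    toList (value (composeOne (Arities.ones m))
      (value (intervals P (m + 1) ◁ unitPoints P m) x)) = toList (left x) := by
  obtain ⟨c, r, hc, h⟩ := exists_toList_eq_concat (left x)
  rw [toList_composeOne_of_eq (c := c) (r := r) hc, right_whiskerLeft, h]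
  · refine (congrArg (fun l => composeList c l ++ [r]) (famToList_unitPoints m _)).trans ?_
    rw [← hc, composeList_replicate]
  · rw [left_whiskerLeft, h]

theorem lastInputLaws_littleIntervals [BraidedCategory P.FullSubcategory] :
    (littleIntervals P).LastInputLaws where
  one_compLast n := intervals_hom_ext (X := 𝟙_ P.FullSubcategory ⊗ intervals P (n + 1)) fun x =>
    (toList_one_composeLast n x).trans ((toList_castObj _ _).trans
      (congrArg toList (value_leftUnitor_hom x))).symm
  compLast_one m := intervals_hom_ext (X := intervals P (m + 1) ⊗ 𝟙_ P.FullSubcategory) fun x =>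
    (toList_composeLast_one m x).trans (congrArg toList (value_rightUnitor_hom x)).symm
  compLast_assoc m n p := intervals_hom_ext
    (X := (intervals P (m + 1) ⊗ intervals P (n + 1)) ⊗ intervals P (p + 1)) fun x =>
    (toList_composeLast_assoc m n p x).trans (toList_castObj _ _).symm
  compOne_append {m n} j k := intervals_hom_ext
    (X := (intervals P (m + 1) ⊗ tensorFam (intervals P) j) ⊗
      (intervals P (n + 1) ⊗ tensorFam (intervals P) k)) fun x =>
    (toList_composeOne_append j k x).trans (toList_castObj _ _).symm
  compOne_ones m := intervals_hom_ext (X := intervals P (m + 1) ⊗ 𝟙_ P.FullSubcategory) fun x =>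
    (toList_composeOne_ones m x).trans ((toList_castObj _ _).trans
      (congrArg toList (value_rightUnitor_hom x))).symm

end Lists

/-! ## Contracting little intervals -/

section Restriction

variable {P : ObjectProperty TopCat.{w}} [CartesianMonoidalCategory P.FullSubcategory]

/-- The restriction of a map on a product to a point of the first factor. -/
def restrictAt {X Y Z : P.FullSubcategory} (h : X ⊗ Y ⟶ Z) (t : X.obj) : Y ⟶ Z :=
  (λ_ Y).inv ≫ constMap t ▷ Y ≫ h

theorem exists_value_restrictAt {X Y Z : P.FullSubcategory} (h : X ⊗ Y ⟶ Z) (t : X.obj)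
    (y : Y.obj) : ∃ p, value (restrictAt h t) y = value h p ∧ left p = t ∧ right p = y :=
  ⟨_, by rw [restrictAt, value_comp, value_comp], by simp, by simp⟩

end Restriction

section Contraction

/-- Halve all intervals but the last one, and replace the last one by `[1/2, 1]`. -/
def halve {m : ℕ} (x : Fin (m + 1) → ℝ × ℝ) : Fin (m + 1) → ℝ × ℝ :=
  Fin.snoc (α := fun _ => ℝ × ℝ) (fun i => (1 / 2 : ℝ) • x i.castSucc) (1 / 2, 1)

theorem halve_mem {m : ℕ} {x : Fin (m + 1) → ℝ × ℝ} (hx : x ∈ intervalSet (m + 1)) :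
    halve x ∈ intervalSet (m + 1) := by
  constructor
  · intro i
    refine Fin.lastCases ?_ (fun i => ?_) i
    · simp only [halve, Fin.snoc_last]
      norm_num
    · obtain ⟨left_nonneg, left_lt_right, right_le_one⟩ := hx.1 i.castSucc
      simp only [halve, Fin.snoc_castSucc, Prod.smul_fst, Prod.smul_snd, smul_eq_mul]
      exact ⟨by linarith, by linarith, by linarith⟩
  · intro i k
    refine Fin.lastCases (fun h => ?_) (fun i => ?_) i
    · exact absurd h (Fin.le_last k).not_gt
    · refine Fin.lastCases (fun _ => ?_) (fun k h => ?_) k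
      · have right_le_one := (hx.1 i.castSucc).2.2
        simp only [halve, Fin.snoc_last, Fin.snoc_castSucc, Prod.smul_snd, smul_eq_mul]
        linarith
      · have right_le_left := hx.2 _ _ h
        simp only [halve, Fin.snoc_castSucc, Prod.smul_fst, Prod.smul_snd, smul_eq_mul]
        linarith

theorem continuous_halve {m : ℕ} : Continuous (halve (m := m)) := by
  refine continuous_pi fun i => Fin.lastCases ?_ (fun i => ?_) i
  · simp only [halve, Fin.snoc_last]
    exact continuous_const
  · simp only [halve, Fin.snoc_castSucc]
    fun_prop

/-- The straight line from `halve x` to `x`. -/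
def contractFun {m : ℕ} (t : ℝ) (x : Fin (m + 1) → ℝ × ℝ) : Fin (m + 1) → ℝ × ℝ :=
  (1 - t) • halve x + t • x

theorem contractFun_mem {m : ℕ} {t : ℝ} (ht : t ∈ Set.Icc (0 : ℝ) 1) {x : Fin (m + 1) → ℝ × ℝ}
    (hx : x ∈ intervalSet (m + 1)) : contractFun t x ∈ intervalSet (m + 1) :=
  convex_intervalSet _ (halve_mem hx) hx (sub_nonneg.2 ht.2) ht.1 (sub_add_cancel 1 t)

theorem continuous_contractFun {m : ℕ} :
    Continuous fun p : ℝ × (Fin (m + 1) → ℝ × ℝ) => contractFun p.1 p.2 :=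
  ((continuous_const.sub continuous_fst).smul (continuous_halve.comp continuous_snd)).add
    (continuous_fst.smul continuous_snd)

/-- The straight line from `[1/2, 1]` to the interval `p`: the effect of `contractFun` on the last
interval. -/
def contractLast (t : ℝ) (p : ℝ × ℝ) : ℝ × ℝ := (1 - t) • (1 / 2, 1) + t • p

theorem ofFn_contractFun {m : ℕ} {t : ℝ} {x : Fin (m + 1) → ℝ × ℝ} {c : List (ℝ × ℝ)} {r : ℝ × ℝ}
    (h : List.ofFn x = c ++ [r]) : List.ofFn (contractFun t x) =
      c.map (rescale (0, (1 + t) / 2)) ++ [contractLast t r] := by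
  rw [List.ofFn_succ_last] at h
  obtain ⟨init_eq, last_eq⟩ := List.append_inj' h rfl
  rw [List.ofFn_succ_last, ← init_eq, ← List.singleton_inj.1 last_eq, List.map_ofFn]
  refine congrArg₂ (fun f a => List.ofFn f ++ [a]) (funext fun i => ?_) ?_
  · simp only [contractFun, halve, rescale, Pi.add_apply, Pi.smul_apply, Fin.snoc_castSucc,
      Function.comp_apply]
    ext <;> simp <;> ring
  · simp [contractFun, halve, contractLast]

variable {P : ObjectProperty TopCat.{w}} [ContainsConvexSets P]

/-- A point of the unit interval as a real number. -/
def coord (t : (unitInterval P).obj) : ℝ := (ULift.down (α := Set.Icc (0 : ℝ) 1) t).1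

variable (P) in
/-- A real number in the unit interval as a point. -/
def ofCoord (t : Set.Icc (0 : ℝ) 1) : (unitInterval P).obj := ULift.up t

@[simp] theorem coord_ofCoord (t : Set.Icc (0 : ℝ) 1) : coord (ofCoord P t) = t.1 := rfl

theorem coord_mem (t : (unitInterval P).obj) : coord t ∈ Set.Icc (0 : ℝ) 1 :=
  (ULift.down (α := Set.Icc (0 : ℝ) 1) t).2

theorem continuous_coord : Continuous (coord (P := P)) :=
  continuous_subtype_val.comp continuous_uliftDown

/-- A tuple of intervals as a point of the space of little intervals. -/
def ofEndpoints {m : ℕ} (x : Fin m → ℝ × ℝ) (hx : x ∈ intervalSet m) : (intervals P m).obj :=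
  ULift.up ⟨x, hx⟩

theorem toList_ofEndpoints {m : ℕ} (x : Fin m → ℝ × ℝ) (hx : x ∈ intervalSet m) :
    toList (P := P) (ofEndpoints x hx) = List.ofFn x := rfl

theorem initialInterval_mem {r : ℝ} (hpos : 0 < r) (hle : r ≤ 1) :
    (fun _ : Fin 1 => ((0 : ℝ), r)) ∈ intervalSet 1 :=
  ⟨fun _ => ⟨le_rfl, hpos, hle⟩, fun i k hik => absurd hik (by simp [Subsingleton.elim i k])⟩

variable (P) in
/-- The path from `[0, 1/2]` to `[0, 1]` which moves the right endpoint linearly. -/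
def growPath : unitInterval P ⟶ intervals P 1 :=
  ObjectProperty.homMk (TopCat.ofHom
    { toFun := fun t : (unitInterval P).obj =>
        ofEndpoints (P := P) (fun _ => (0, (1 + coord t) / 2))
          (initialInterval_mem (by linarith [(coord_mem t).1]) (by linarith [(coord_mem t).2]))
      continuous_toFun := continuous_uliftUp.comp (Continuous.subtype_mk
        (continuous_pi fun _ => continuous_const.prodMk
          ((continuous_const.add continuous_coord).div_const 2)) _) })

theorem toList_growPath (t : (unitInterval P).obj) :
    toList (value (growPath P) t) = [(0, (1 + coord t) / 2)] :=
  List.ofFn_succ.trans rfl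

variable (P) in
/-- The point `[0, 1/2], [1/2, 1]`. -/
def halves : (intervals P 2).obj :=
  ofEndpoints ![(0, 1 / 2), (1 / 2, 1)] (by
    constructor
    · intro i
      fin_cases i <;> norm_num
    · intro i k
      fin_cases i <;> fin_cases k <;> norm_num)

theorem toList_halves : toList (halves P) = [(0, 1 / 2)] ++ [(1 / 2, 1)] := by
  refine (toList_ofEndpoints (P := P) _ _).trans ?_
  simp

variable [CartesianMonoidalCategory P.FullSubcategory]

variable (P) in
/-- The straight-line homotopy `contractFun` on spaces of little intervals. -/
def contract (m : ℕ) : unitInterval P ⊗ intervals P (m + 1) ⟶ intervals P (m + 1) :=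
  ObjectProperty.homMk (TopCat.ofHom
    { toFun := fun p : (unitInterval P ⊗ intervals P (m + 1)).obj =>
        ofEndpoints (P := P) (contractFun (coord (left p)) (endpoints (right p)))
        (contractFun_mem (coord_mem _) (endpoints_mem _))
      continuous_toFun := continuous_uliftUp.comp (Continuous.subtype_mk
        (continuous_contractFun.comp
          ((continuous_coord.comp
              (fst (unitInterval P) (intervals P (m + 1))).hom.hom.continuous).prodMk
            (continuous_endpoints.comp
              (snd (unitInterval P) (intervals P (m + 1))).hom.hom.continuous))) _) })

theorem toList_contract {m : ℕ} {p : (unitInterval P ⊗ intervals P (m + 1)).obj}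
    {c : List (ℝ × ℝ)} {r : ℝ × ℝ} (h : toList (right p) = c ++ [r]) :
    toList (value (contract P m) p) =
      c.map (rescale (0, (1 + coord (left p)) / 2)) ++ [contractLast (coord (left p)) r] :=
  ofFn_contractFun (t := coord (left p)) h

theorem contract_composeOne {m : ℕ} (j : Arities m) :
    unitInterval P ◁ composeOne j ≫ contract P j.sum =
      (α_ _ _ _).inv ≫ contract P m ▷ tensorFam (intervals P) j ≫ composeOne j :=
  intervals_hom_ext fun x => by
    obtain ⟨c, r, hc, h⟩ := exists_toList_eq_concat (left (right x))
    rw [value_comp, value_comp, value_comp, toList_contract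
      ((congrArg toList (right_whiskerLeft _ _)).trans (toList_composeOne_of_eq hc h)),
      toList_composeOne_of_eq (c := c.map (rescale (0, (1 + coord (left x)) / 2)))
        (r := contractLast (coord (left x)) r) (by simp [hc]), composeList_map_rescale]
    · simp
    · rw [left_whiskerRight, toList_contract (c := c) (r := r)] <;> simp [h]

variable (P) in
/-- The map which forgets the last interval. -/
def dropLast (m : ℕ) : intervals P (m + 1) ⟶ intervals P m :=
  (ρ_ _).inv ≫ intervals P (m + 1) ◁ emptyIntervals P ≫ composeLast P m 0

theorem toList_emptyIntervals (t : (𝟙_ P.FullSubcategory).obj) :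
    toList (value (emptyIntervals P) t) = [] := by
  simp [toList]

theorem toList_dropLast {m : ℕ} {x : (intervals P (m + 1)).obj}
    {c : List (ℝ × ℝ)} {r : ℝ × ℝ} (hc : c.length = m) (h : toList x = c ++ [r]) :
    toList (value (dropLast P m) x) = c := by
  rw [dropLast, value_comp, value_comp]
  refine (toList_composeLast_of_eq (q := 0) (c := c) (r := r) hc ?_).trans ?_
  · rw [left_whiskerLeft, left_rightUnitor_inv, h]
  · rw [right_whiskerLeft, toList_emptyIntervals, List.map_nil, List.append_nil]

variable (P) in
/-- The canonical isomorphism from `C(m)` to a product with one factor. -/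
def singleInput (m : ℕ) : intervals P m ⟶ tensorFam (intervals P) (Arities.snoc Arities.nil m) :=
  (λ_ (intervals P m)).inv

theorem famToList_singleInput {m : ℕ} (x : (intervals P m).obj) :
    famToList (Arities.snoc Arities.nil m) (value (singleInput P m) x) = [toList x] :=
  congrArg (fun l => [l]) (congrArg toList (right_leftUnitor_inv x))

variable (P) in
/-- The map which squeezes all intervals into `[0, 1/2]` and adds the interval `[1/2, 1]`, obtained
by inserting the intervals into the first input of `halves`. -/
def squeeze (m : ℕ) : intervals P m ⟶ intervals P (m + 1) :=
  restrictAt (intervals P 2 ◁ singleInput P m ≫ composeOne (Arities.snoc Arities.nil m))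
      (halves P) ≫
    castObj (intervals P) (congrArg (· + 1) (Nat.zero_add m))

theorem toList_squeeze {m : ℕ} (x : (intervals P m).obj) :
    toList (value (squeeze P m) x) = (toList x).map (rescale (0, 1 / 2)) ++ [(1 / 2, 1)] := by
  obtain ⟨p, hp, left_eq, right_eq⟩ := exists_value_restrictAt (intervals P 2 ◁ singleInput P m ≫
    composeOne (Arities.snoc Arities.nil m)) (halves P) x
  refine (toList_castObj _ _).trans ((congrArg toList (hp.trans (value_comp _ _ _))).trans
    ((toList_composeOne_of_eq (m := 1) (j := Arities.snoc Arities.nil m) (c := [(0, 1 / 2)])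
      (r := (1 / 2, 1)) rfl ?_).trans ?_))
  · rw [left_whiskerLeft, left_eq, toList_halves]
  · rw [right_whiskerLeft, famToList_singleInput, right_eq, composeList_singleton]

theorem toList_restrictAt_contract {m : ℕ} (t : Set.Icc (0 : ℝ) 1) {x : (intervals P (m + 1)).obj}
    {c : List (ℝ × ℝ)} {r : ℝ × ℝ} (h : toList x = c ++ [r]) :
    toList (value (restrictAt (contract P m) (ofCoord P t)) x) =
      c.map (rescale (0, (1 + t) / 2)) ++ [contractLast t r] := by
  obtain ⟨p, hp, left_eq, right_eq⟩ := exists_value_restrictAt (contract P m) (ofCoord P t) x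
  rw [hp, toList_contract ((congrArg toList right_eq).trans h), left_eq, coord_ofCoord]

theorem restrictAt_contract_one (m : ℕ) : restrictAt (contract P m) (ofCoord P 1) = 𝟙 _ :=
  intervals_hom_ext fun x => by
    obtain ⟨c, r, -, h⟩ := exists_toList_eq_concat x
    rw [toList_restrictAt_contract 1 h, value_id, h]
    norm_num [contractLast, funext zero_one_rescale]

theorem restrictAt_contract_zero (m : ℕ) :
    restrictAt (contract P m) (ofCoord P 0) = dropLast P m ≫ squeeze P m :=
  intervals_hom_ext fun x => by
    obtain ⟨c, r, hc, h⟩ := exists_toList_eq_concat x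
    rw [toList_restrictAt_contract 0 h, value_comp, toList_squeeze, toList_dropLast hc h]
    simp [contractLast]

theorem constMap_growPath_zero : constMap (X := 𝟙_ P.FullSubcategory) (ofCoord P 0) ≫ growPath P =
    constMap (halves P) ≫ dropLast P 1 :=
  intervals_hom_ext fun x => by
    rw [value_comp, value_comp, value_constMap, value_constMap, toList_growPath,
      toList_dropLast (m := 1) rfl toList_halves]
    simp

theorem constMap_growPath_one : constMap (X := 𝟙_ P.FullSubcategory) (ofCoord P 1) ≫ growPath P =
    unitPoint P :=
  intervals_hom_ext fun x => by
    rw [value_comp, value_constMap, toList_growPath, toList_unitPoint]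
    simp

end Contraction

/-! ## The homotopy equivalence -/

section Coherence

variable {M : Type u} [Category.{v} M] [MonoidalCategory M]

theorem whiskerLeft_whiskerLeft_associator_inv_whiskerRight {K U V X Y : M} (g : X ⟶ Y)
    (h : K ⊗ U ⟶ V) :
    K ◁ (U ◁ g) ≫ (α_ _ _ _).inv ≫ h ▷ Y = ((α_ _ _ _).inv ≫ h ▷ X) ≫ V ◁ g := by
  rw [Category.assoc, associator_inv_naturality_right_assoc, whisker_exchange]

theorem whiskerLeft_comp_associator_inv_whiskerRight {K U V X Y B : M} (g : X ⟶ Y ⊗ B)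
    (h : K ⊗ U ⟶ U) (c : U ⊗ Y ⟶ V) (h' : K ⊗ V ⟶ V)
    (comm : K ◁ c ≫ h' = (α_ _ _ _).inv ≫ h ▷ Y ≫ c) :
    K ◁ (U ◁ g ≫ (α_ _ _ _).inv ≫ c ▷ B) ≫ (α_ _ _ _).inv ≫ h' ▷ B =
      ((α_ _ _ _).inv ≫ h ▷ X) ≫ U ◁ g ≫ (α_ _ _ _).inv ≫ c ▷ B := by
  have comm_whiskered := congrArg (fun f => f ▷ B) comm
  simp only [comp_whiskerRight] at comm_whiskered
  simp only [MonoidalCategory.whiskerLeft_comp, Category.assoc,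
    associator_inv_naturality_middle_assoc, comm_whiskered]
  rw [← whisker_exchange_assoc, associator_inv_naturality_left_assoc]
  simp

theorem leftUnitor_inv_associator_inv_whiskerRight {K U V : M} (B : M) (k : 𝟙_ M ⟶ K)
    (h : K ⊗ U ⟶ V) :
    (λ_ (U ⊗ B)).inv ≫ k ▷ (U ⊗ B) ≫ (α_ _ _ _).inv ≫ h ▷ B =
      ((λ_ U).inv ≫ k ▷ U ≫ h) ▷ B := by
  simp

theorem whiskerLeft_μ_map_of_comm {C : Type*} [Category* C] [MonoidalCategory C] (L : C ⥤ M)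
    [L.Monoidal] {U X S Y : C} {T : M} (t : T ⟶ L.obj S) (c : X ⊗ S ⟶ Y) (h : U ⊗ X ⟶ X)
    (h' : U ⊗ Y ⟶ Y) (comm : U ◁ c ≫ h' = (α_ _ _ _).inv ≫ h ▷ S ≫ c) :
    L.obj U ◁ (L.obj X ◁ t ≫ μ L X S ≫ L.map c) ≫ μ L U Y ≫ L.map h' =
      (α_ _ _ _).inv ≫ (μ L U X ≫ L.map h) ▷ T ≫ L.obj X ◁ t ≫ μ L X S ≫ L.map c := by
  have map_comm := congrArg (fun f => L.map f) comm
  simp only [L.map_comp] at map_comm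
  simp only [MonoidalCategory.whiskerLeft_comp, Category.assoc, μ_natural_right_assoc, map_comm,
    associativity_inv_assoc]
  rw [comp_whiskerRight_assoc, ← whisker_exchange_assoc, μ_natural_left_assoc,
    ← whisker_exchange_assoc]
  simp

end Coherence

section Enriched

variable {P : ObjectProperty TopCat.{w}} [CartesianMonoidalCategory P.FullSubcategory]
  {M : Type u} [Category.{v} M] [MonoidalCategory M] (L : P.FullSubcategory ⥤ M) [L.Monoidal]

/-- The map `1 ⟶ L X` given by a point of `X`. -/
def mapPoint {X : P.FullSubcategory} (x : X.obj) : 𝟙_ M ⟶ L.obj X :=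
  ε L ≫ L.map (constMap x)

theorem mapPoint_map {X Y : P.FullSubcategory} (x : X.obj) (f : X ⟶ Y) :
    mapPoint L x ≫ L.map f = ε L ≫ L.map (constMap x ≫ f) := by
  rw [mapPoint, Category.assoc, L.map_comp]

theorem leftUnitor_inv_mapPoint {X Y Z : P.FullSubcategory} (h : X ⊗ Y ⟶ Z) (x : X.obj) :
    (λ_ (L.obj Y)).inv ≫ mapPoint L x ▷ L.obj Y ≫ μ L X Y ≫ L.map h = L.map (restrictAt h x) := by
  rw [mapPoint, comp_whiskerRight_assoc, μ_natural_left_assoc, left_unitality_inv_assoc,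
    ← L.map_comp, ← L.map_comp, restrictAt]

variable [ContainsConvexSets P]

theorem inclAt_braiding [SymmetricCategory M] {X Y : M} (t : Set.Icc (0 : ℝ) 1)
    (h : L.obj (unitInterval P) ⊗ X ⟶ Y) : inclAt L X t ≫ (β_ _ _).hom ≫ h =
      (λ_ X).inv ≫ mapPoint L (ofCoord P t) ▷ X ≫ h := by
  have naturality :=
    BraidedCategory.braiding_naturality_right_assoc X (mapPoint L (ofCoord P t)) h
  refine (Category.assoc _ _ _).trans ((congrArg _ naturality).trans ?_)
  simp

theorem Homotopic.of_left [SymmetricCategory M] {X Y : M} {f g : X ⟶ Y}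
    (h : L.obj (unitInterval P) ⊗ X ⟶ Y)
    (hf : (λ_ X).inv ≫ mapPoint L (ofCoord P 0) ▷ X ≫ h = f)
    (hg : (λ_ X).inv ≫ mapPoint L (ofCoord P 1) ▷ X ≫ h = g) : Homotopic L f g :=
  ⟨(β_ _ _).hom ≫ h, by rw [inclAt_braiding, hf], by rw [inclAt_braiding, hg]⟩

variable (P) in
/-- The image of the operad of little intervals in the enriching category. -/
abbrev enriched : OperadData M := (littleIntervals P).map L

theorem map_composeOne_contract {m : ℕ} (j : Arities m) :
    L.obj (unitInterval P) ◁ (enriched P L).compOne j ≫ μ L (unitInterval P) _ ≫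
        L.map (contract P j.sum) =
      (α_ _ _ _).inv ≫ (μ L _ _ ≫ L.map (contract P m)) ▷
        tensorFam (fun n => L.obj (intervals P n)) j ≫ (enriched P L).compOne j := by
  rw [OperadData.map_compOne]
  exact whiskerLeft_μ_map_of_comm L _ _ _ _ (contract_composeOne j)

variable [SymmetricCategory M] (A : OperadAlgebra (enriched P L))

/-- The homotopy on `L C(m+1) ⊗ A^(m)` induced by the contraction of little intervals. -/
def summandContract (m : ℕ) : L.obj (unitInterval P) ⊗ A.envSummand m ⟶ A.envSummand m :=
  (α_ _ (L.obj (intervals P (m + 1))) (tensorPow A.X m)).inv ≫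
    (μ L _ _ ≫ L.map (contract P m)) ▷ tensorPow A.X m

/-- The homotopy on a relation of the enveloping algebra induced by the contraction of little
intervals. -/
def relationContract {m : ℕ} (j : Arities m) :
    L.obj (unitInterval P) ⊗ A.envRelation ⟨m, j⟩ ⟶ A.envRelation ⟨m, j⟩ :=
  (α_ _ (L.obj (intervals P (m + 1)))
      (tensorFam (fun n => L.obj (intervals P n) ⊗ tensorPow A.X n) j)).inv ≫
    (μ L _ _ ≫ L.map (contract P m)) ▷
      tensorFam (fun n => L.obj (intervals P n) ⊗ tensorPow A.X n) j

theorem relationAct_summandContract {m : ℕ} (j : Arities m) :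
    L.obj (unitInterval P) ◁ A.relationAct j ≫ summandContract L A m =
      relationContract L A j ≫ A.relationAct j :=
  whiskerLeft_whiskerLeft_associator_inv_whiskerRight _ _

theorem relationComp_summandContract {m : ℕ} (j : Arities m) :
    L.obj (unitInterval P) ◁ A.relationComp j ≫ summandContract L A j.sum =
      relationContract L A j ≫ A.relationComp j :=
  whiskerLeft_comp_associator_inv_whiskerRight _ _ _ _ (map_composeOne_contract L j)

theorem leftUnitor_inv_summandContract (m : ℕ) (t : Set.Icc (0 : ℝ) 1) :
    (λ_ (A.envSummand m)).inv ≫ mapPoint L (ofCoord P t) ▷ A.envSummand m ≫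
        summandContract L A m =
      (L.map (restrictAt (contract P m) (ofCoord P t)) ▷ tensorPow A.X m :
        L.obj (intervals P (m + 1)) ⊗ tensorPow A.X m ⟶ _) := by
  rw [← leftUnitor_inv_mapPoint]
  exact leftUnitor_inv_associator_inv_whiskerRight _ _ _

variable [HasCountableColimits M] [MonoidalClosed M]

/-- The homotopy on the enveloping algebra induced by the contraction of little intervals. -/
def envContract : L.obj (unitInterval P) ⊗ A.env ⟶ A.env :=
  A.tensorEnvDesc (fun m => summandContract L A m ≫ A.summandι m) fun _ j => by
    rw [reassoc_of% relationAct_summandContract L A j,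
      reassoc_of% relationComp_summandContract L A j, A.relationAct_summandι]

theorem whiskerLeft_summandι_envContract (m : ℕ) :
    L.obj (unitInterval P) ◁ A.summandι m ≫ envContract L A =
      summandContract L A m ≫ A.summandι m :=
  A.whiskerLeft_summandι_tensorEnvDesc _ _ m

theorem summandι_leftUnitor_inv_envContract (t : Set.Icc (0 : ℝ) 1) (m : ℕ) :
    A.summandι m ≫ (λ_ A.env).inv ≫ mapPoint L (ofCoord P t) ▷ A.env ≫ envContract L A =
      (L.map (restrictAt (contract P m) (ofCoord P t)) ▷ tensorPow A.X m :
        A.envSummand m ⟶ A.envSummand m) ≫ A.summandι m := by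
  rw [leftUnitor_inv_naturality_assoc, whisker_exchange_assoc, whiskerLeft_summandι_envContract]
  exact ((Category.assoc _ _ _).trans (congrArg _ (Category.assoc _ _ _))).symm.trans
    (congrArg (· ≫ A.summandι m) (leftUnitor_inv_summandContract L A m t))

end Enriched

section Coherence

variable {M : Type u} [Category.{v} M] [MonoidalCategory M]

theorem comp_leftUnitor_inv_tensorHom_of_whiskerLeft {W B X Y Z V T : M} (a : W ⊗ B ⟶ X)
    (o : 𝟙_ M ⟶ Z) (f : X ⟶ Y) (i : Z ⊗ Y ⟶ T) (c : Z ⊗ W ⟶ V) (i' : V ⊗ B ⟶ T)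
    (h : Z ◁ (a ≫ f) ≫ i = (α_ _ _ _).inv ≫ c ▷ B ≫ i') :
    a ≫ (λ_ X).inv ≫ (o ⊗ₘ f) ≫ i = ((λ_ W).inv ≫ o ▷ W ≫ c) ▷ B ≫ i' := by
  rw [leftUnitor_inv_naturality_assoc, whiskerLeft_comp_tensorHom_assoc,
    MonoidalCategory.tensorHom_def, Category.assoc, h,
    reassoc_of% leftUnitor_inv_associator_inv_whiskerRight]

theorem whiskerLeft_comp_associator_inv_of_tensorHom {Z W W' W'' B B' V V' T : M}
    (u : W ⊗ B ⟶ W') (r : W' ⟶ W'' ⊗ B') (w : W ⟶ W'') (b : B ⟶ B') (c : Z ⊗ W'' ⟶ V)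
    (k : V ⟶ V') (i : V ⊗ B' ⟶ T) (i' : V' ⊗ B ⟶ T) (hr : u ≫ r = (w ⊗ₘ b))
    (hi : V ◁ b ≫ i = k ▷ B ≫ i') :
    Z ◁ u ≫ (Z ◁ r ≫ (α_ _ _ _).inv ≫ c ▷ B') ≫ i =
      (α_ _ _ _).inv ≫ (Z ◁ w ≫ c ≫ k) ▷ B ≫ i' := by
  have exchange : Z ◁ W'' ◁ b ≫ (α_ _ _ _).inv ≫ c ▷ B' ≫ i =
      (α_ _ _ _).inv ≫ (c ≫ k) ▷ B ≫ i' := by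
    rw [associator_inv_naturality_right_assoc, whisker_exchange_assoc, hi,
      comp_whiskerRight_assoc]
  rw [Category.assoc, ← MonoidalCategory.whiskerLeft_comp_assoc, hr,
    MonoidalCategory.tensorHom_def, MonoidalCategory.whiskerLeft_comp_assoc, Category.assoc,
    exchange, associator_inv_naturality_middle_assoc, ← comp_whiskerRight_assoc]

variable [BraidedCategory M]

theorem leftUnitor_inv_tensorμ (X Y : M) :
    (λ_ (X ⊗ Y)).inv ≫ (λ_ (𝟙_ M)).inv ▷ (X ⊗ Y) ≫ tensorμ (𝟙_ M) (𝟙_ M) X Y =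
      ((λ_ X).inv ⊗ₘ (λ_ Y).inv) := by
  rw [← cancel_mono ((λ_ X).hom ⊗ₘ (λ_ Y).hom), Category.assoc, Category.assoc,
    ← tensor_left_unitality]
  simp

theorem rightUnitor_inv_tensorμ (X Y : M) :
    (ρ_ (X ⊗ Y)).inv ≫ (X ⊗ Y) ◁ (ρ_ (𝟙_ M)).inv ≫ tensorμ X Y (𝟙_ M) (𝟙_ M) =
      ((ρ_ X).inv ⊗ₘ (ρ_ Y).inv) := by
  rw [← cancel_mono ((ρ_ X).hom ⊗ₘ (ρ_ Y).hom), Category.assoc, Category.assoc,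
    ← unitors_inv_equal, ← tensor_right_unitality]
  simp

theorem rightUnitor_inv_nullary_tensorμ {X Y Z : M} (o : 𝟙_ M ⟶ Z) :
    (ρ_ (X ⊗ Y)).inv ≫ (X ⊗ Y) ◁ (o ≫ (ρ_ Z).inv) ≫ tensorμ X Y Z (𝟙_ M) =
      ((ρ_ X).inv ≫ X ◁ o) ⊗ₘ (ρ_ Y).inv := by
  have naturality := tensorμ_natural_right X Y o (𝟙 (𝟙_ M))
  rw [tensorHom_id, MonoidalCategory.whiskerLeft_id] at naturality
  rw [rightUnitor_inv_naturality, MonoidalCategory.whiskerLeft_comp_assoc, naturality,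
    reassoc_of% rightUnitor_inv_tensorμ, tensorHom_comp_tensorHom, Category.comp_id]

theorem rightUnitor_inv_nullary_of_tensorμ {X Y Z W V T : M} (o : 𝟙_ M ⟶ Z) (z : Z ⊗ 𝟙_ M ⟶ W)
    (c : X ⊗ Z ⟶ V) (a : V ⊗ Y ⟶ T) (a' : X ⊗ (Y ⊗ W) ⟶ T)
    (assoc : tensorμ X Y Z (𝟙_ M) ≫ (c ⊗ₘ (ρ_ Y).hom) ≫ a = (α_ _ _ _).hom ≫ X ◁ Y ◁ z ≫ a') :
    (ρ_ (X ⊗ Y)).inv ≫ (X ⊗ Y) ◁ (o ≫ (ρ_ Z).inv ≫ z) ≫ (α_ _ _ _).hom ≫ a' =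
      ((ρ_ X).inv ≫ X ◁ o ≫ c) ▷ Y ≫ a := by
  rw [← Category.assoc o, MonoidalCategory.whiskerLeft_comp_assoc,
    associator_naturality_right_assoc, ← assoc, reassoc_of% rightUnitor_inv_nullary_tensorμ,
    tensorHom_comp_tensorHom_assoc, Iso.inv_hom_id, tensorHom_id, Category.assoc]

theorem leftUnitor_inv_regroup_single (X : ℕ → M) (A : M) (m : ℕ) :
    (λ_ (X m ⊗ tensorPow A m)).inv ≫ regroup X A (Arities.snoc Arities.nil m) =
      ((λ_ (X m)).inv ⊗ₘ castObj (tensorPow A) (Nat.zero_add m).symm) := by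
  have regroup_nil : regroup X A Arities.nil = (λ_ (𝟙_ M)).inv :=
    (congrArg (_ ≫ ·) (MonoidalCategory.whiskerLeft_id _ _)).trans (Category.comp_id _)
  have regroup_single : regroup X A (Arities.snoc Arities.nil m) =
      (λ_ (𝟙_ M)).inv ▷ (X m ⊗ tensorPow A m) ≫ tensorμ (𝟙_ M) (𝟙_ M) (X m) (tensorPow A m) ≫
        (𝟙_ M ⊗ X m) ◁ ((λ_ _).hom ≫ castObj (tensorPow A) (Nat.zero_add m).symm) :=
    (regroup_snoc X A Arities.nil m).trans (congrArg₂ (fun f g => f ▷ _ ≫ tensorμ _ _ _ _ ≫ _ ◁ g)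
      regroup_nil (tensorPowAdd_zero_left A m))
  have unitality : (λ_ (X m ⊗ tensorPow A m)).inv ≫ (λ_ (𝟙_ M)).inv ▷ (X m ⊗ tensorPow A m) ≫
      tensorμ (𝟙_ M) (𝟙_ M) (X m) (tensorPow A m) ≫
        (𝟙_ M ⊗ X m) ◁ ((λ_ _).hom ≫ castObj (tensorPow A) (Nat.zero_add m).symm) =
      ((λ_ (X m)).inv ⊗ₘ castObj (tensorPow A) (Nat.zero_add m).symm) := by
    rw [reassoc_of% leftUnitor_inv_tensorμ (X m) (tensorPow A m), tensorHom_comp_whiskerLeft,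
      Iso.inv_hom_id_assoc]
  exact (congrArg (_ ≫ ·) regroup_single).trans unitality

end Coherence

namespace OperadAlgebra

variable {M : Type u} [Category.{v} M] [MonoidalCategory M] [SymmetricCategory M]
  {O : OperadData M} (A : OperadAlgebra O)

theorem summandSmul_nullary (o : 𝟙_ M ⟶ O.obj 0) (m : ℕ) :
    (ρ_ (A.envSummand m)).inv ≫ A.envSummand m ◁ (o ≫ (ρ_ (O.obj 0)).inv ≫ A.act 0) ≫
        A.summandSmul m =
      ((ρ_ (O.obj (m + 1))).inv ≫ O.obj (m + 1) ◁ o ≫ O.compLastOp m 0) ▷ tensorPow A.X m ≫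
        A.act m :=
  rightUnitor_inv_nullary_of_tensorμ o (A.act 0) (O.compLastOp m 0) (A.act m) (A.act (m + 1))
    (A.compLastOp_act m 0)

theorem leftUnitor_inv_relationAct_single (m : ℕ) :
    O.obj 2 ◁ (λ_ (O.obj m ⊗ tensorPow A.X m)).inv ≫
        A.relationAct (Arities.snoc Arities.nil m) =
      O.obj 2 ◁ (A.act m ≫ toPowOne A.X) := by
  refine (MonoidalCategory.whiskerLeft_comp _ _ _).symm.trans (congrArg (O.obj 2 ◁ ·) ?_)
  exact (congrArg (_ ≫ ·) (id_tensorHom _ _)).trans (leftUnitor_inv_naturality _).symm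

variable [HasCountableColimits M]

theorem whiskerLeft_castObj_summandι {m n : ℕ} (h : m = n) :
    O.obj (m + 1) ◁ castObj (tensorPow A.X) h.symm ≫ A.summandι m =
      castObj O.obj (congrArg (· + 1) h) ▷ tensorPow A.X n ≫ A.summandι n := by
  subst h; simp

theorem leftUnitor_inv_relationComp_single_summandι (m : ℕ) :
    O.obj 2 ◁ (λ_ (O.obj m ⊗ tensorPow A.X m)).inv ≫
        A.relationComp (Arities.snoc Arities.nil m) ≫ A.summandι (0 + m) =
      (α_ _ _ _).inv ≫ (O.obj 2 ◁ (λ_ (O.obj m)).inv ≫ O.compOne (Arities.snoc Arities.nil m) ≫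
        castObj O.obj (congrArg (· + 1) (Nat.zero_add m))) ▷ tensorPow A.X m ≫ A.summandι m :=
  whiskerLeft_comp_associator_inv_of_tensorHom _ _ _ _ _ _ _ _
    (leftUnitor_inv_regroup_single O.obj A.X m) (A.whiskerLeft_castObj_summandι (Nat.zero_add m))

theorem whiskerLeft_act_summandι_one (m : ℕ) :
    O.obj 2 ◁ (A.act m ≫ toPowOne A.X) ≫ A.summandι 1 =
      (α_ _ _ _).inv ≫ (O.obj 2 ◁ (λ_ (O.obj m)).inv ≫ O.compOne (Arities.snoc Arities.nil m) ≫
        castObj O.obj (congrArg (· + 1) (Nat.zero_add m))) ▷ tensorPow A.X m ≫ A.summandι m :=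
  calc O.obj 2 ◁ (A.act m ≫ toPowOne A.X) ≫ A.summandι 1
    _ = (O.obj 2 ◁ (λ_ _).inv ≫ A.relationAct (Arities.snoc Arities.nil m)) ≫ A.summandι 1 :=
      congrArg (· ≫ A.summandι 1) (A.leftUnitor_inv_relationAct_single m).symm
    _ = O.obj 2 ◁ (λ_ _).inv ≫ A.relationComp (Arities.snoc Arities.nil m) ≫
          A.summandι (0 + m) :=
      (Category.assoc _ _ _).trans
        (congrArg (_ ≫ ·) (A.relationAct_summandι (Arities.snoc Arities.nil m)))
    _ = _ := A.leftUnitor_inv_relationComp_single_summandι m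

theorem act_summandι_one (o : 𝟙_ M ⟶ O.obj 2) (m : ℕ) :
    A.act m ≫ (λ_ A.X).inv ≫ (o ⊗ₘ toPowOne A.X) ≫ A.summandι 1 =
      ((λ_ (O.obj m)).inv ≫ o ▷ O.obj m ≫ O.obj 2 ◁ (λ_ (O.obj m)).inv ≫
        O.compOne (Arities.snoc Arities.nil m) ≫
          castObj O.obj (congrArg (· + 1) (Nat.zero_add m))) ▷ tensorPow A.X m ≫
        A.summandι m :=
  comp_leftUnitor_inv_tensorHom_of_whiskerLeft _ _ _ _ _ _ (A.whiskerLeft_act_summandι_one m)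

namespace EnvStructure

variable {A} (E : A.EnvStructure) (e : 𝟙_ M ⟶ A.X)

theorem isModuleMap_orbitMap : E.IsModuleMap (E.orbitMap e) := by
  let _ := E.mon
  let _ := E.mod
  let _ := ModObj.regular A.env
  refine ⟨?_⟩
  have mul_smul : E.mon.mul ▷ A.X ≫ E.mod.smul =
      (α_ _ _ _).hom ≫ A.env ◁ E.mod.smul ≫ E.mod.smul :=
    ModObj.mul_smul (M := A.env) (X := A.X)
  change E.mon.mul ≫ (ρ_ A.env).inv ≫ A.env ◁ e ≫ E.mod.smul =
    A.env ◁ ((ρ_ A.env).inv ≫ A.env ◁ e ≫ E.mod.smul) ≫ E.mod.smul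
  rw [rightUnitor_inv_naturality_assoc, ← whisker_exchange_assoc, mul_smul]
  simp

theorem summandι_orbitMap (m : ℕ) :
    A.summandι m ≫ E.orbitMap e =
      (ρ_ (A.envSummand m)).inv ≫ A.envSummand m ◁ e ≫ A.summandSmul m := by
  have ι_smul : A.summandι m ▷ A.X ≫ E.mod.smul = A.summandSmul m := E.ι_smul m
  rw [orbitMap, rightUnitor_inv_naturality_assoc, ← whisker_exchange_assoc, ι_smul]

end EnvStructure

end OperadAlgebra

section Equivalence

variable {P : ObjectProperty TopCat.{w}} [CartesianMonoidalCategory P.FullSubcategory]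
  {M : Type u} [Category.{v} M] [MonoidalCategory M] (L : P.FullSubcategory ⥤ M) [L.Monoidal]

theorem leftUnitor_inv_mapPoint_leftUnitor_inv {X Y Z : P.FullSubcategory} {T : M} (x : X.obj)
    (c : X ⊗ (𝟙_ _ ⊗ Y) ⟶ Z) (d : L.obj Z ⟶ T) :
    (λ_ (L.obj Y)).inv ≫ mapPoint L x ▷ L.obj Y ≫ L.obj X ◁ (λ_ (L.obj Y)).inv ≫
        (L.obj X ◁ (ε L ▷ L.obj Y ≫ μ L _ _) ≫ μ L _ _ ≫ L.map c) ≫ d =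
      L.map (restrictAt (X ◁ (λ_ Y).inv ≫ c) x) ≫ d := by
  rw [← leftUnitor_inv_mapPoint, L.map_comp, ← μ_natural_right_assoc, ← left_unitality_inv]
  simp only [MonoidalCategory.whiskerLeft_comp, Category.assoc]

theorem rightUnitor_inv_map_point {X Y Z : P.FullSubcategory} (e : 𝟙_ _ ⟶ Y) (c : X ⊗ Y ⟶ Z) :
    (ρ_ (L.obj X)).inv ≫ L.obj X ◁ (ε L ≫ L.map e) ≫ μ L X Y ≫ L.map c =
      L.map ((ρ_ X).inv ≫ X ◁ e ≫ c) := by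
  rw [MonoidalCategory.whiskerLeft_comp_assoc, μ_natural_right_assoc,
    right_unitality_inv_assoc, ← L.map_comp, ← L.map_comp]

theorem whiskerRight_comp_of_comp_eq {B X Y Z T U : M} {a : Y ⊗ B ⟶ T} {g : T ⟶ U} {s : Y ⟶ Z}
    {i : Z ⊗ B ⟶ U} (h : a ≫ g = s ▷ B ≫ i) (d : X ⟶ Y) :
    (d ▷ B ≫ a) ≫ g = (d ≫ s) ▷ B ≫ i := by
  rw [Category.assoc, h, comp_whiskerRight_assoc]

theorem tensorHom_comp_of_comp_eq {B V W X Y S T U : M} {i : X ⊗ S ⟶ T} {o : T ⟶ U} {d : X ⟶ Y}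
    {a : Y ⊗ S ⟶ U} (h : i ≫ o = d ▷ S ≫ a) (z : V ⟶ X) (b : B ⟶ S) (p : W ⟶ V ⊗ B) :
    (p ≫ (z ⊗ₘ b) ≫ i) ≫ o = p ≫ (z ≫ d ⊗ₘ b) ≫ a := by
  rw [Category.assoc, Category.assoc, h, tensorHom_comp_whiskerRight_assoc]

variable [ContainsConvexSets P]

theorem map_dropLast (m : ℕ) :
    (ρ_ (L.obj (intervals P (m + 1)))).inv ≫ L.obj (intervals P (m + 1)) ◁
      (ε L ≫ L.map (emptyIntervals P)) ≫ (enriched P L).compLastOp m 0 =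
        L.map (dropLast P m) := by
  rw [OperadData.map_compLastOp]
  exact rightUnitor_inv_map_point L (emptyIntervals P) (composeLast P m 0)

theorem map_squeeze (m : ℕ) :
    (λ_ (L.obj (intervals P m))).inv ≫ mapPoint L (halves P) ▷ L.obj (intervals P m) ≫
        L.obj (intervals P 2) ◁ (λ_ (L.obj (intervals P m))).inv ≫
          (enriched P L).compOne (Arities.snoc Arities.nil m) ≫
            castObj (enriched P L).obj (congrArg (· + 1) (Nat.zero_add m)) =
      L.map (squeeze P m) := by
  rw [squeeze, L.map_comp, map_castObj, OperadData.map_compOne]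
  exact leftUnitor_inv_mapPoint_leftUnitor_inv L (halves P)
    (composeOne (Arities.snoc Arities.nil m)) _

variable [SymmetricCategory M] (A : OperadAlgebra (enriched P L))

theorem summandSmul_algebraUnit (m : ℕ) :
    (ρ_ (A.envSummand m)).inv ≫ A.envSummand m ◁ algebraUnit L A ≫ A.summandSmul m =
      L.map (dropLast P m) ▷ tensorPow A.X m ≫ A.act m := by
  have unit_eq : algebraUnit L A =
      (ε L ≫ L.map (emptyIntervals P)) ≫ (ρ_ _).inv ≫ A.act 0 :=
    (Category.assoc _ _ _).symm
  rw [unit_eq]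
  exact (A.summandSmul_nullary (ε L ≫ L.map (emptyIntervals P)) m).trans
    (congrArg (fun f => f ▷ tensorPow A.X m ≫ A.act m) (map_dropLast L m))

theorem leftUnitor_inv_mapPoint_growPath (t : Set.Icc (0 : ℝ) 1) :
    (λ_ A.X).inv ≫ mapPoint L (ofCoord P t) ▷ A.X ≫
        (L.map (growPath P) ⊗ₘ toPowOne A.X) ≫ A.act 1 =
      (λ_ A.X).inv ≫
        (ε L ≫ L.map (constMap (ofCoord P t) ≫ growPath P) ⊗ₘ toPowOne A.X) ≫ A.act 1 := by
  rw [← mapPoint_map]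
  exact congrArg (_ ≫ ·) (whiskerRight_comp_tensorHom_assoc _ _ _ _)

variable [HasCountableColimits M]

/-- The homotopy inverse `A ⟶ env A` of the orbit map of the unit of `A`: it places an element of
`A` in the first of the two halves `[0, 1/2]`, `[1/2, 1]`. -/
def homotopyInverse : A.X ⟶ A.env :=
  (λ_ A.X).inv ≫ (mapPoint L (halves P) ⊗ₘ toPowOne A.X) ≫ A.summandι 1

theorem act_homotopyInverse (m : ℕ) :
    A.act m ≫ homotopyInverse L A = L.map (squeeze P m) ▷ tensorPow A.X m ≫ A.summandι m := by
  rw [← map_squeeze]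
  exact A.act_summandι_one (mapPoint L (halves P)) m

theorem summandι_orbitMap_homotopyInverse (E : A.EnvStructure) (m : ℕ) :
    A.summandι m ≫ E.orbitMap (algebraUnit L A) ≫ homotopyInverse L A =
      L.map (restrictAt (contract P m) (ofCoord P 0)) ▷ tensorPow A.X m ≫ A.summandι m := by
  rw [reassoc_of% E.summandι_orbitMap, reassoc_of% summandSmul_algebraUnit L A m,
    restrictAt_contract_zero, L.map_comp]
  exact whiskerRight_comp_of_comp_eq (act_homotopyInverse L A m) _

theorem homotopic_orbitMap_comp [MonoidalClosed M] (E : A.EnvStructure) :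
    Homotopic L (E.orbitMap (algebraUnit L A) ≫ homotopyInverse L A) (𝟙 A.env) := by
  refine Homotopic.of_left L (envContract L A) (A.env_hom_ext fun m => ?_)
    (A.env_hom_ext fun m => ?_)
  · rw [summandι_leftUnitor_inv_envContract, summandι_orbitMap_homotopyInverse]
  · rw [summandι_leftUnitor_inv_envContract, restrictAt_contract_one, L.map_id]
    exact (congrArg (· ≫ A.summandι m) (id_whiskerRight _ _)).trans
      ((Category.id_comp _).trans (Category.comp_id _).symm)

theorem homotopyInverse_orbitMap (E : A.EnvStructure) :
    homotopyInverse L A ≫ E.orbitMap (algebraUnit L A) =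
      (λ_ A.X).inv ≫ (mapPoint L (halves P) ≫ L.map (dropLast P 1) ⊗ₘ toPowOne A.X) ≫
        A.act 1 :=
  tensorHom_comp_of_comp_eq ((E.summandι_orbitMap _ 1).trans (summandSmul_algebraUnit L A 1)) _ _ _

theorem homotopic_comp_orbitMap (E : A.EnvStructure) :
    Homotopic L (homotopyInverse L A ≫ E.orbitMap (algebraUnit L A)) (𝟙 A.X) := by
  refine Homotopic.of_left L ((L.map (growPath P) ⊗ₘ toPowOne A.X) ≫ A.act 1) ?_ ?_
  · rw [leftUnitor_inv_mapPoint_growPath, constMap_growPath_zero, homotopyInverse_orbitMap,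
      mapPoint_map]
  · rw [leftUnitor_inv_mapPoint_growPath, constMap_growPath_one]
    exact (Category.assoc _ _ _).symm.trans A.insertOne_act

end Equivalence

end LittleIntervals

end

theorem mainTheorem7_general {P : ObjectProperty TopCat.{w}} [LittleIntervals.ContainsConvexSets P]
    [CartesianMonoidalCategory P.FullSubcategory] [BraidedCategory P.FullSubcategory]
    {M : Type u} [Category.{v} M] [MonoidalCategory M] [SymmetricCategory M] [MonoidalClosed M]
    [HasCountableColimits M]
    (L : P.FullSubcategory ⥤ M) [L.Braided]
    (A : LittleIntervals.OperadAlgebra ((LittleIntervals.littleIntervals P).map L)) :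
    Nonempty A.EnvStructure ∧
      ∀ E : A.EnvStructure,
        E.IsModuleMap (E.orbitMap (LittleIntervals.algebraUnit L A)) ∧
          LittleIntervals.IsHomotopyEquivalence L
            (E.orbitMap (LittleIntervals.algebraUnit L A)) :=
  ⟨⟨A.envStructure (LittleIntervals.lastInputLaws_littleIntervals.map L)⟩, fun E =>
    ⟨E.isModuleMap_orbitMap _, LittleIntervals.homotopyInverse L A,
      LittleIntervals.homotopic_orbitMap_comp L A E,
      LittleIntervals.homotopic_comp_orbitMap L A E⟩⟩

theorem mainTheorem7 {P : ObjectProperty TopCat.{w}} [LittleIntervals.ContainsConvexSets P]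
    [CartesianMonoidalCategory P.FullSubcategory] [BraidedCategory P.FullSubcategory]
    {M : Type u} [Category.{v} M] [MonoidalCategory M] [SymmetricCategory M] [MonoidalClosed M]
    [HasCountableColimits M]
    (L : P.FullSubcategory ⥤ M) [L.Braided] [L.IsLeftAdjoint]
    (A : LittleIntervals.OperadAlgebra ((LittleIntervals.littleIntervals P).map L)) :
    Nonempty A.EnvStructure ∧
      ∀ E : A.EnvStructure,
        E.IsModuleMap (E.orbitMap (LittleIntervals.algebraUnit L A)) ∧
          LittleIntervals.IsHomotopyEquivalence L
            (E.orbitMap (LittleIntervals.algebraUnit L A)) :=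
  mainTheorem7_general L A
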